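/- Let $\mathbb S^1=\mathbb R/\mathbb Z$ and let $H^k=H^k(\mathbb S^1;\mathbb R^2)$ be the Sobolev space with norm $\|u\|_{H^k}^2=\sum_{j=0}^{k}\|\partial_x^j u\|_{L^2}^2$. For $\eta\in H^2\hookrightarrow C^1$ let $$|\eta|_*=\inf_{x\ne y}\frac{|\eta(x)-\eta(y)|}{d_{\mathbb S^1}(x,y)},\qquad d_{\mathbb S^1}(x,y)=\min_{k\in\mathbb Z}|x-y-k|,$$ and let $V=\{\eta\in H^2: |\eta|_*>0\}$. For $\eta\in V$ let $A(\eta)=\frac{1}{\pi|\partial_x\eta|^2}\,\partial_x^2$, viewed as an operator in $H^1$ with domain $H^3$. For $T>0$ let $$\mathbb E(0,T)=H^1(0,T;H^1)\cap L^2(0,T;H^3),\qquad \|\gamma\|_{\mathbb E(0,T)}^2=\|\gamma\|_{L^2(0,T;H^1)}^2+\|\partial_t\gamma\|_{L^2(0,T;H^1)}^2+\|\gamma\|_{L^2(0,T;H^3)}^2 .$$ Proposition 4.13. For every $\eta\in V$ the operator $A(\eta)$ has maximal $L^2$-regularity on $H^1$. More precisely, for every $T>0$ and every $g\in L^2(0,T;H^1)$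 there is a unique $\gamma\in\mathbb E(0,T)$ that solves $$\partial_t\gamma=A(\eta)\gamma+g\ \text{ in } \mathbb S^1\times(0,T),\qquad \gamma(0)=0,$$ where $\gamma(0)$ is the value at $0$ of the continuous representative of $\gamma$. Moreover, for every $\eta\in V$ and $T>0$ there is a constant $C>0$, independent of $g$, such that for all $g\in L^2(0,T;H^1)$ this solution satisfies $$\|\gamma\|_{\mathbb E(0,T)}\le C\|g\|_{L^2(0,T;H^1)} .$$ -/

import Mathlib

open MeasureTheory Set Filter Topology
open scoped ContDiff ENNReal

namespace ILLSS

noncomputable section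

/-- Integration of an `L²` function against a fixed scalar `L²` function is a continuous linear
map. -/
theorem exists_testPairing {α E : Type*} [MeasurableSpace α] {μ : Measure α}
    [NormedAddCommGroup E] [NormedSpace ℝ E] [CompleteSpace E]
    {φ : α → ℝ} (hφ : MemLp φ 2 μ) :
    ∃ L : Lp E 2 μ →L[ℝ] E, ∀ f : Lp E 2 μ, ∫ x, φ x • f x ∂μ = L f := by
  refine ⟨(ContinuousLinearMap.lsmul ℝ ℝ : ℝ →L[ℝ] E →L[ℝ] E).lpPairing μ 2 2 (hφ.toLp φ), ?_⟩
  intro f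
  rw [ContinuousLinearMap.lpPairing_eq_integral]
  refine integral_congr_ae ?_
  filter_upwards [hφ.coeFn_toLp] with x hx
  simp [hx]

/-! ### Sobolev spaces on the circle `S¹ = ℝ / ℤ` with values in the plane -/

/-- The Euclidean plane `ℝ²`. -/
abbrev Plane : Type := EuclideanSpace ℝ (Fin 2)

/-- `L²(S¹; ℝ²)`, where `S¹ = ℝ / ℤ` carries the Lebesgue measure (of total mass one). -/
abbrev L2 : Type := Lp Plane 2 (volume : Measure UnitAddCircle)

/-- Smooth real-valued functions on the circle. -/
def IsTest (φ : UnitAddCircle → ℝ) : Prop :=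
  ContDiff ℝ ∞ (fun s : ℝ => φ (s : UnitAddCircle))

/-- The derivative `∂ₓφ` of a function on the circle. -/
def circDeriv (φ : UnitAddCircle → ℝ) (x : UnitAddCircle) : ℝ :=
  deriv (fun s : ℝ => φ (x + (s : UnitAddCircle))) 0

/-- `g` is the weak derivative `∂ₓf` of `f` on the circle. -/
def IsWeakDeriv (f g : L2) : Prop :=
  ∀ φ : UnitAddCircle → ℝ, IsTest φ → ∫ x, circDeriv φ x • f x = -∫ x, φ x • g x

theorem IsTest.continuous {φ : UnitAddCircle → ℝ} (h : IsTest φ) : Continuous φ :=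
  continuous_coinduced_dom.2 (ContDiff.continuous h)

theorem circDeriv_coe (φ : UnitAddCircle → ℝ) (s : ℝ) :
    circDeriv φ (s : UnitAddCircle) = deriv (fun r : ℝ => φ (r : UnitAddCircle)) s := by
  have h := deriv_comp_const_add (fun r : ℝ => φ (r : UnitAddCircle)) s 0
  simpa [circDeriv, AddCircle.coe_add] using h

theorem IsTest.continuous_circDeriv {φ : UnitAddCircle → ℝ} (h : IsTest φ) :
    Continuous (circDeriv φ) := by
  refine continuous_coinduced_dom.2 ?_
  have : (circDeriv φ ∘ ((↑) : ℝ → UnitAddCircle)) =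
      deriv (fun r : ℝ => φ (r : UnitAddCircle)) := funext (circDeriv_coe φ)
  exact this ▸ ContDiff.continuous_deriv h (by simp)

theorem memLp_circle {φ : UnitAddCircle → ℝ} (h : Continuous φ) :
    MemLp φ 2 (volume : Measure UnitAddCircle) :=
  (h.memLp_of_hasCompactSupport (HasCompactSupport.of_compactSpace φ))

/-- The Sobolev space `Hᵏ(S¹; ℝ²)`: an element `u` is recorded as the tuple
`(u, ∂ₓu, …, ∂ₓᵏu)` of the function and its weak derivatives, all of them in `L²`. It is a
subspace of the Hilbert sum of `k + 1` copies of `L²`, so that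
`‖u‖² = ∑_{j ≤ k} ‖∂ₓʲu‖²_{L²}`. -/
def H (k : ℕ) : Submodule ℝ (PiLp 2 (fun _ : Fin (k + 1) => L2)) where
  carrier := {u | ∀ j : Fin k, IsWeakDeriv (u j.castSucc) (u j.succ)}
  zero_mem' := by
    intro j φ hφ
    obtain ⟨L, hL⟩ := exists_testPairing (E := Plane) (memLp_circle hφ.continuous)
    obtain ⟨M, hM⟩ := exists_testPairing (E := Plane) (memLp_circle hφ.continuous_circDeriv)
    rw [hL, hM]
    simp
  add_mem' := by
    intro u v hu hv j φ hφ
    obtain ⟨L, hL⟩ := exists_testPairing (E := Plane) (memLp_circle hφ.continuous)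
    obtain ⟨M, hM⟩ := exists_testPairing (E := Plane) (memLp_circle hφ.continuous_circDeriv)
    have h1 := hu j φ hφ
    have h2 := hv j φ hφ
    rw [hL, hM] at h1 h2 ⊢
    simp only [PiLp.add_apply, map_add, h1, h2]
    abel
  smul_mem' := by
    intro c u hu j φ hφ
    obtain ⟨L, hL⟩ := exists_testPairing (E := Plane) (memLp_circle hφ.continuous)
    obtain ⟨M, hM⟩ := exists_testPairing (E := Plane) (memLp_circle hφ.continuous_circDeriv)
    have h1 := hu j φ hφ
    rw [hL, hM] at h1 ⊢
    simp only [PiLp.smul_apply, map_smul, h1, smul_neg]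

theorem isClosed_H (k : ℕ) : IsClosed (H k : Set (PiLp 2 (fun _ : Fin (k + 1) => L2))) := by
  have hset : (H k : Set (PiLp 2 (fun _ : Fin (k + 1) => L2))) =
      ⋂ (j : Fin k) (φ : UnitAddCircle → ℝ) (_ : IsTest φ),
        {u | ∫ x, circDeriv φ x • u j.castSucc x = -∫ x, φ x • u j.succ x} := by
    ext u
    simp [H, IsWeakDeriv]
  rw [hset]
  refine isClosed_iInter fun j => isClosed_iInter fun φ => isClosed_iInter fun hφ => ?_
  obtain ⟨L, hL⟩ := exists_testPairing (E := Plane) (memLp_circle hφ.continuous)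
  obtain ⟨M, hM⟩ := exists_testPairing (E := Plane) (memLp_circle hφ.continuous_circDeriv)
  simp only [hL, hM]
  exact isClosed_eq (M.continuous.comp (PiLp.continuous_apply 2 _ _))
    (L.continuous.comp (PiLp.continuous_apply 2 _ _)).neg

instance instCompleteSpaceH (k : ℕ) : CompleteSpace (H k) :=
  (isClosed_H k).completeSpace_coe

/-- The weak derivative `∂ₓʲu ∈ L²` of `u ∈ Hᵏ`, for `j ≤ k`. -/
def der {k : ℕ} (u : H k) (j : Fin (k + 1)) : L2 :=
  (u : PiLp 2 (fun _ : Fin (k + 1) => L2)) j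

/-- `u ∈ Hᵏ` as an element of `L²`. -/
def toL2 {k : ℕ} (u : H k) : L2 := der u 0

/-! ### Admissible curves and the operator `A(η)` -/

/-- The chord-arc constant of a closed curve. The distance on `ℝ / ℤ` is the geodesic one,
`min_{k ∈ ℤ} |x - y - k|`. -/
def chordArc (c : UnitAddCircle → Plane) : ℝ :=
  ⨅ p : {p : UnitAddCircle × UnitAddCircle // p.1 ≠ p.2},
    ‖c p.1.1 - c p.1.2‖ / dist p.1.1 p.1.2

/-- The admissible set: the curves in `H²(S¹; ℝ²)` whose (unique) continuous representative has
positive chord-arc constant. -/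
def V : Set (H 2) :=
  {η | ∃ c : C(UnitAddCircle, Plane), (⇑c =ᵐ[volume] ⇑(toL2 η)) ∧ 0 < chordArc c}

/-- The differential operator `A(η) = (π |∂ₓη|²)⁻¹ ∂ₓ²` applied to `v ∈ H³`. -/
def A (η : H 2) (v : H 3) : UnitAddCircle → Plane :=
  fun x => (Real.pi * ‖der η 1 x‖ ^ 2)⁻¹ • der v 2 x

/-! ### Function spaces in time -/

/-- Lebesgue measure on the time interval `(0, T)`. -/
abbrev timeMeasure (T : ℝ) : Measure ℝ := volume.restrict (Ioo 0 T)

/-- The Bochner space `L²(0, T; X)`. -/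
abbrev TimeL2 (T : ℝ) (X : Type*) [NormedAddCommGroup X] : Type _ := Lp X 2 (timeMeasure T)

theorem memLp_time {T : ℝ} {φ : ℝ → ℝ} (h : Continuous φ) (hc : HasCompactSupport φ) :
    MemLp φ 2 (timeMeasure T) :=
  h.memLp_of_hasCompactSupport hc

/-- The space `H¹(0, T; X)`: an element `u` is recorded as the pair `(u, ∂ₜu)` of the function and
its weak derivative, with `‖u‖² = ‖u‖²_{L²(0,T;X)} + ‖∂ₜu‖²_{L²(0,T;X)}`. -/
def TimeH1 (T : ℝ) (X : Type*) [NormedAddCommGroup X] [NormedSpace ℝ X] [CompleteSpace X] :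
    Submodule ℝ (WithLp 2 (TimeL2 T X × TimeL2 T X)) where
  carrier := {p | ∀ φ : ℝ → ℝ, ContDiff ℝ ∞ φ → HasCompactSupport φ → tsupport φ ⊆ Ioo 0 T →
    ∫ t in Ioo 0 T, deriv φ t • p.fst t = -∫ t in Ioo 0 T, φ t • p.snd t}
  zero_mem' := by
    intro φ hφ hc _
    obtain ⟨L, hL⟩ := exists_testPairing (E := X) (memLp_time (T := T) hφ.continuous hc)
    obtain ⟨M, hM⟩ := exists_testPairing (E := X)
      (memLp_time (T := T) (hφ.continuous_deriv (by simp)) hc.deriv)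
    rw [hL, hM]
    simp
  add_mem' := by
    intro u v hu hv φ hφ hc hs
    obtain ⟨L, hL⟩ := exists_testPairing (E := X) (memLp_time (T := T) hφ.continuous hc)
    obtain ⟨M, hM⟩ := exists_testPairing (E := X)
      (memLp_time (T := T) (hφ.continuous_deriv (by simp)) hc.deriv)
    have h1 := hu φ hφ hc hs
    have h2 := hv φ hφ hc hs
    rw [hL, hM] at h1 h2 ⊢
    simp only [WithLp.add_fst, WithLp.add_snd, map_add, h1, h2]
    abel
  smul_mem' := by
    intro c u hu φ hφ hc hs
    obtain ⟨L, hL⟩ := exists_testPairing (E := X) (memLp_time (T := T) hφ.continuous hc)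
    obtain ⟨M, hM⟩ := exists_testPairing (E := X)
      (memLp_time (T := T) (hφ.continuous_deriv (by simp)) hc.deriv)
    have h1 := hu φ hφ hc hs
    rw [hL, hM] at h1 ⊢
    simp only [WithLp.smul_fst, WithLp.smul_snd, map_smul, h1, smul_neg]

/-- The maximal regularity space `E(0,T) = H¹(0,T;H¹) ∩ L²(0,T;H³)`: an element is recorded as the
pair of its two incarnations in `H¹(0,T;H¹)` and `L²(0,T;H³)`, which are the same function, and
`‖γ‖² = ‖γ‖²_{H¹(0,T;H¹)} + ‖γ‖²_{L²(0,T;H³)}`. -/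
def E (T : ℝ) : Submodule ℝ (WithLp 2 (TimeH1 T (H 1) × TimeL2 T (H 3))) where
  carrier := {p | ∀ᵐ t ∂timeMeasure T, toL2 (p.fst.1.fst t) = toL2 (p.snd t)}
  zero_mem' := by
    filter_upwards [Lp.coeFn_zero (H 1) 2 (timeMeasure T),
      Lp.coeFn_zero (H 3) 2 (timeMeasure T)] with t h1 h2
    change toL2 ((0 : Lp (H 1) 2 (timeMeasure T)) t) = toL2 ((0 : Lp (H 3) 2 (timeMeasure T)) t)
    rw [h1, h2]
    simp [toL2, der]
  add_mem' := by
    intro p q hp hq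
    filter_upwards [hp, hq, Lp.coeFn_add p.fst.1.fst q.fst.1.fst,
      Lp.coeFn_add p.snd q.snd] with t h1 h2 h3 h4
    simp only [WithLp.add_fst, WithLp.add_snd, Submodule.coe_add, h3, h4, Pi.add_apply]
    simp only [toL2, der] at h1 h2 ⊢
    simp [h1, h2]
  smul_mem' := by
    intro c p hp
    filter_upwards [hp, Lp.coeFn_smul c p.fst.1.fst, Lp.coeFn_smul c p.snd] with t h1 h3 h4
    simp only [WithLp.smul_fst, WithLp.smul_snd, Submodule.coe_smul, h3, h4, Pi.smul_apply]
    simp only [toL2, der] at h1 ⊢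
    simp [h1]

/-- `γ ∈ E(0,T)` as a curve in `H¹`. -/
def inH1 {T : ℝ} (γ : E T) : TimeL2 T (H 1) := γ.1.fst.1.fst

/-- The weak time derivative `∂ₜγ ∈ L²(0,T;H¹)` of `γ ∈ E(0,T)`. -/
def dt {T : ℝ} (γ : E T) : TimeL2 T (H 1) := γ.1.fst.1.snd

/-- `γ ∈ E(0,T)` as a curve in `H³`. -/
def inH3 {T : ℝ} (γ : E T) : TimeL2 T (H 3) := γ.1.snd

/-- `γ ∈ E(0,T)` solves `∂ₜγ = A(η)γ + g` in `S¹ × (0,T)`, `γ(0) = 0`, where `γ(0)` is the value at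
`0` of the (unique) representative of `γ` that is continuous on `[0,T]`. -/
def IsSolution {T : ℝ} (η : H 2) (g : TimeL2 T (H 1)) (γ : E T) : Prop :=
  (∀ᵐ t ∂timeMeasure T, ∀ᵐ x : UnitAddCircle,
    toL2 (dt γ t) x = A η (inH3 γ t) x + toL2 (g t) x) ∧
  ∃ c : ℝ → H 1, ContinuousOn c (Icc 0 T) ∧ c =ᵐ[timeMeasure T] inH1 γ ∧ c 0 = 0

end

end ILLSS

/-!
Let `M` and `D` be the operators on `H¹` representing `∫ π|∂ₓη|²⟪u, v⟫` and `∫ ⟪∂ₓu, ∂ₓv⟫` in `L²`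
form, so that `∂ₜγ = A(η)γ + g` becomes `M ∂ₜγ + D γ = M g`. Here `M + D` is coercive and
`R = (M + D)⁻¹ M` is self-adjoint for its inner product. Acting on `L²(0, T; H¹)`, `R` commutes with
the Volterra operator `J`, and `p = ∂ₜγ` solves `(R + J - R J) p = R g`. Testing against `R p` and
using that `J` is accretive bounds `R p` and shows that `R + J - R J` has dense range, hence is
invertible on the range of `R`. Finally `R` maps `H¹` into `H³`, since `H¹` is stable under
multiplication by the weight `π|∂ₓη|²`, and this gives the bound in `L²(0, T; H³)`.
-/

namespace ILLSS

noncomputable section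

section Primitive

variable {E F G : Type*} [NormedAddCommGroup E] [NormedAddCommGroup F] [NormedAddCommGroup G]
  {a b : ℝ}

theorem intervalIntegrable_congr_ae_Ioo (hab : a ≤ b) {g k : ℝ → E}
    (hgk : ∀ᵐ t ∂volume.restrict (Ioo a b), g t = k t) (hg : IntervalIntegrable g volume a b) :
    IntervalIntegrable k volume a b := by
  rw [intervalIntegrable_iff_integrableOn_Ioo_of_le hab] at hg ⊢
  exact hg.congr_fun_ae hgk

theorem intervalIntegrable_mono {g : ℝ → E} (hg : IntervalIntegrable g volume a b) {s t : ℝ}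
    (hs : s ∈ Icc a b) (ht : t ∈ Icc a b) : IntervalIntegrable g volume s t :=
  hg.mono_set (uIcc_subset_uIcc (Icc_subset_uIcc hs) (Icc_subset_uIcc ht))

variable [NormedSpace ℝ E] [NormedSpace ℝ F] [NormedSpace ℝ G]

theorem continuousOn_primitive (hab : a ≤ b) {g : ℝ → E} (hg : IntervalIntegrable g volume a b) :
    ContinuousOn (fun t => ∫ r in a..t, g r) (Icc a b) := by
  simpa only [uIcc_of_le hab] using
    intervalIntegral.continuousOn_primitive_interval' hg left_mem_uIcc

theorem intervalIntegrable_bilin_left (B : E →L[ℝ] F →L[ℝ] G) (hab : a ≤ b) {g : ℝ → E} {k : ℝ → F}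
    (hg : IntervalIntegrable g volume a b) (hk : ContinuousOn k (Icc a b)) :
    IntervalIntegrable (fun t => B (g t) (k t)) volume a b := by
  rw [intervalIntegrable_iff_integrableOn_Ioc_of_le hab] at hg ⊢
  obtain ⟨C, hC⟩ := isCompact_Icc.exists_bound_of_continuousOn hk
  refine Integrable.mono' (g := fun t => ‖B‖ * C * ‖g t‖) (hg.norm.const_mul _)
    (B.aestronglyMeasurable_comp₂ hg.aestronglyMeasurable
      ((hk.mono Ioc_subset_Icc_self).aestronglyMeasurable measurableSet_Ioc)) ?_
  filter_upwards [ae_restrict_mem measurableSet_Ioc] with t ht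
  refine (B.le_opNorm₂ _ _).trans ?_
  rw [mul_right_comm]
  gcongr
  exact hC t (Ioc_subset_Icc_self ht)

theorem integral_congr_ae_Ioo {g k : ℝ → E} (hgk : ∀ᵐ t ∂volume.restrict (Ioo a b), g t = k t)
    {t : ℝ} (ht : t ∈ Icc a b) : ∫ r in a..t, g r = ∫ r in a..t, k r := by
  simp only [intervalIntegral.integral_of_le ht.1, integral_Ioc_eq_integral_Ioo]
  exact integral_congr_ae
    (ae_restrict_of_ae_restrict_of_subset (Ioo_subset_Ioo_right ht.2) hgk)

variable [CompleteSpace E] [CompleteSpace F] [CompleteSpace G]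

/-- Fubini's theorem on the triangle `a < r ≤ t ≤ b`. -/
theorem integral_bilin_primitive_right (B : E →L[ℝ] F →L[ℝ] G) (hab : a ≤ b) {g : ℝ → E}
    {k : ℝ → F} (hg : IntervalIntegrable g volume a b) (hk : IntervalIntegrable k volume a b) :
    ∫ t in a..b, B (g t) (∫ r in a..t, k r) = ∫ r in a..b, B (∫ t in r..b, g t) (k r) := by
  rw [intervalIntegrable_iff_integrableOn_Ioc_of_le hab] at hg hk
  have hD : MeasurableSet {z : ℝ × ℝ | z.2 ≤ z.1} := measurableSet_le measurable_snd measurable_fst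
  have hint : Integrable (Function.uncurry fun t r =>
      {z : ℝ × ℝ | z.2 ≤ z.1}.indicator (fun z => B (g z.1) (k z.2)) (t, r))
      ((volume.restrict (Ioc a b)).prod (volume.restrict (Ioc a b))) :=
    (hg.op_fst_snd B.continuous₂ ⟨‖B‖, B.le_opNorm₂⟩ hk).indicator hD
  rw [intervalIntegral.integral_of_le hab, intervalIntegral.integral_of_le hab]
  refine Eq.trans (setIntegral_congr_fun measurableSet_Ioc fun t ht => ?_)
    ((integral_integral_swap hint).trans (setIntegral_congr_fun measurableSet_Ioc fun r hr => ?_))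
  · have hset : Ioc a t = Ioc a b ∩ Iic t := by
      rw [Ioc_inter_Iic, min_eq_right ht.2]
    rw [intervalIntegral.integral_of_le ht.1.le, hset, ← setIntegral_indicator measurableSet_Iic,
      ← (B (g t)).integral_comp_comm (hk.indicator measurableSet_Iic)]
    simp [indicator, apply_ite]
  · have hset : Icc r b = Ioc a b ∩ Ici r := by
      ext t
      simp only [mem_Icc, mem_inter_iff, mem_Ioc, mem_Ici]
      exact ⟨fun h => ⟨⟨hr.1.trans_le h.1, h.2⟩, h.1⟩, fun h => ⟨h.2, h.1.2⟩⟩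
    rw [intervalIntegral.integral_of_le hr.2, ← integral_Icc_eq_integral_Ioc (x := r), hset,
      ← setIntegral_indicator measurableSet_Ici, ← B.flip_apply,
      ← (B.flip (k r)).integral_comp_comm (hg.indicator measurableSet_Ici)]
    simp [indicator, apply_ite]

theorem integral_bilin_primitive_add (B : E →L[ℝ] F →L[ℝ] G) (hab : a ≤ b) {g : ℝ → E}
    {k : ℝ → F} (hg : IntervalIntegrable g volume a b) (hk : IntervalIntegrable k volume a b) :
    ∫ t in a..b, (B (g t) (∫ r in a..t, k r) + B (∫ r in a..t, g r) (k t)) =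
      B (∫ t in a..b, g t) (∫ t in a..b, k t) := by
  have hGk : IntervalIntegrable (fun t => B (∫ r in a..t, g r) (k t)) volume a b :=
    intervalIntegrable_bilin_left B.flip hab hk (continuousOn_primitive hab hg)
  have hgK := intervalIntegrable_bilin_left B hab hg (continuousOn_primitive hab hk)
  rw [intervalIntegral.integral_add hgK hGk, integral_bilin_primitive_right B hab hg hk,
    ← ContinuousLinearMap.intervalIntegral_comp_comm _ hk]
  have hsplit : ∀ t ∈ Icc a b, (∫ r in t..b, g r) = (∫ r in a..b, g r) - ∫ r in a..t, g r :=
    fun t ht => (intervalIntegral.integral_interval_sub_left hg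
      (hg.mono_set (by simpa [uIcc_of_le, ht.1, hab] using Icc_subset_Icc_right ht.2))).symm
  rw [← eq_sub_iff_add_eq, ← intervalIntegral.integral_sub _ hGk]
  · refine intervalIntegral.integral_congr fun t ht => ?_
    simp only [hsplit t (by rwa [uIcc_of_le hab] at ht), map_sub, sub_apply]
  · exact ⟨(B _).integrable_comp hk.1, (B _).integrable_comp hk.2⟩

theorem integral_bilin_primitive (B : E →L[ℝ] F →L[ℝ] G) (hab : a ≤ b) (u : E) (v : F)
    {g : ℝ → E} {k : ℝ → F} (hg : IntervalIntegrable g volume a b)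
    (hk : IntervalIntegrable k volume a b) :
    ∫ t in a..b, (B (g t) (v + ∫ r in a..t, k r) + B (u + ∫ r in a..t, g r) (k t)) =
      B (u + ∫ t in a..b, g t) (v + ∫ t in a..b, k t) - B u v := by
  have hgv : IntervalIntegrable (fun t => B.flip v (g t)) volume a b :=
    ⟨(B.flip v).integrable_comp hg.1, (B.flip v).integrable_comp hg.2⟩
  have huk : IntervalIntegrable (fun t => B u (k t)) volume a b :=
    ⟨(B u).integrable_comp hk.1, (B u).integrable_comp hk.2⟩
  have hgK := intervalIntegrable_bilin_left B hab hg (continuousOn_primitive hab hk)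
  have hGk : IntervalIntegrable (fun t => B (∫ r in a..t, g r) (k t)) volume a b :=
    intervalIntegrable_bilin_left B.flip hab hk (continuousOn_primitive hab hg)
  calc _ = ∫ t in a..b, ((B.flip v (g t) + B u (k t)) +
        (B (g t) (∫ r in a..t, k r) + B (∫ r in a..t, g r) (k t))) := by
        congr 1
        ext t
        simp only [map_add, add_apply, B.flip_apply]
        abel
    _ = _ := by
        rw [intervalIntegral.integral_add (hgv.add huk) (hgK.add hGk),
          intervalIntegral.integral_add hgv huk, integral_bilin_primitive_add B hab hg hk,
          ContinuousLinearMap.intervalIntegral_comp_comm _ hg,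
          ContinuousLinearMap.intervalIntegral_comp_comm _ hk]
        simp only [map_add, add_apply, B.flip_apply]
        abel

end Primitive

section WeakDerivative

variable {E : Type*} [NormedAddCommGroup E] [NormedSpace ℝ E] {a b : ℝ}

/-- `φ` is a real-valued test function on `U ⊆ ℝ`: smooth, with compact support inside `U`. -/
structure IsTestOn (U : Set ℝ) (φ : ℝ → ℝ) : Prop where
  contDiff : ContDiff ℝ ∞ φ
  hasCompactSupport : HasCompactSupport φ
  tsupport_subset : tsupport φ ⊆ U

/-- `g` is the weak derivative of `f` on `U ⊆ ℝ`. -/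
def IsWeakDerivOn (f g : ℝ → E) (U : Set ℝ) : Prop :=
  ∀ φ, IsTestOn U φ → ∫ t in U, deriv φ t • f t = -∫ t in U, φ t • g t

namespace IsTestOn

variable {U : Set ℝ} {φ ψ : ℝ → ℝ}

theorem eq_zero (hφ : IsTestOn U φ) {x : ℝ} (hx : x ∉ U) : φ x = 0 :=
  image_eq_zero_of_notMem_tsupport fun h => hx (hφ.tsupport_subset h)

theorem deriv (hφ : IsTestOn U φ) : IsTestOn U (deriv φ) where
  contDiff := (contDiff_infty_iff_deriv.1 hφ.contDiff).2
  hasCompactSupport := hφ.hasCompactSupport.deriv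
  tsupport_subset := (tsupport_deriv_subset (f := φ)).trans hφ.tsupport_subset

theorem sub_const_mul (hφ : IsTestOn U φ) (hψ : IsTestOn U ψ) (c : ℝ) :
    IsTestOn U (fun x => φ x - c * ψ x) where
  contDiff := hφ.contDiff.sub (contDiff_const.mul hψ.contDiff)
  hasCompactSupport := hφ.hasCompactSupport.sub hψ.hasCompactSupport.mul_left
  tsupport_subset := (tsupport_sub φ _).trans
    (union_subset hφ.tsupport_subset ((tsupport_mul_subset_right).trans hψ.tsupport_subset))

theorem integrable (hφ : IsTestOn U φ) : Integrable φ :=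
  hφ.contDiff.continuous.integrable_of_hasCompactSupport hφ.hasCompactSupport

theorem integrable_smul (hφ : IsTestOn U φ) {μ : Measure ℝ} {f : ℝ → E} (hf : Integrable f μ) :
    Integrable (fun t => φ t • f t) μ := by
  obtain ⟨C, hC⟩ := hφ.hasCompactSupport.exists_bound_of_continuous hφ.contDiff.continuous
  exact hf.bdd_smul C hφ.contDiff.continuous.aestronglyMeasurable (Eventually.of_forall hC)

theorem setIntegral_eq (hφ : IsTestOn U φ) : ∫ t in U, φ t = ∫ t, φ t :=
  setIntegral_eq_integral_of_forall_compl_eq_zero fun _ ht => hφ.eq_zero ht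

end IsTestOn

theorem exists_isTestOn_integral_eq_one (hab : a < b) :
    ∃ ρ : ℝ → ℝ, IsTestOn (Ioo a b) ρ ∧ ∫ t, ρ t = 1 := by
  let ρ : ContDiffBump ((a + b) / 2) := ⟨(b - a) / 8, (b - a) / 4, by linarith, by linarith⟩
  refine ⟨ρ.normed volume, ⟨ρ.contDiff_normed, ρ.hasCompactSupport_normed, ?_⟩, ρ.integral_normed⟩
  rw [ρ.tsupport_normed_eq, Real.closedBall_eq_Icc]
  exact Icc_subset_Ioo (by simp only [ρ]; linarith) (by simp only [ρ]; linarith)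

theorem exists_Icc_of_isCompact_subset_Ioo {K : Set ℝ} (hK : IsCompact K) (hKab : K ⊆ Ioo a b) :
    ∃ c d, K ⊆ Icc c d ∧ Icc c d ⊆ Ioo a b := by
  rcases K.eq_empty_or_nonempty with rfl | hne
  · exact ⟨1, 0, empty_subset _, by simp⟩
  · obtain ⟨c, hcK, hc⟩ := hK.exists_isLeast hne
    obtain ⟨d, hdK, hd⟩ := hK.exists_isGreatest hne
    exact ⟨c, d, fun x hx => ⟨hc hx, hd hx⟩, Icc_subset_Ioo (hKab hcK).1 (hKab hdK).2⟩

theorem hasDerivAt_integral_Iic {ψ : ℝ → ℝ} (hψ : Continuous ψ) (hi : Integrable ψ) (x : ℝ) :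
    HasDerivAt (fun x => ∫ t in Iic x, ψ t) (ψ x) x := by
  have h : (fun x => ∫ t in Iic x, ψ t) = fun x => (∫ t in (0 : ℝ)..x, ψ t) + ∫ t in Iic 0, ψ t :=
    funext fun x => by
      rw [← intervalIntegral.integral_Iic_sub_Iic hi.integrableOn hi.integrableOn, sub_add_cancel]
  rw [h]
  exact (intervalIntegral.integral_hasDerivAt_right (hψ.intervalIntegrable _ _)
    (hψ.stronglyMeasurableAtFilter _ _) hψ.continuousAt).add_const _

theorem IsTestOn.exists_deriv_eq {ψ : ℝ → ℝ} (hψ : IsTestOn (Ioo a b) ψ) (h0 : ∫ t, ψ t = 0) :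
    ∃ φ, IsTestOn (Ioo a b) φ ∧ _root_.deriv φ = ψ := by
  have hderiv := hasDerivAt_integral_Iic hψ.contDiff.continuous hψ.integrable
  have hderiv_eq : _root_.deriv (fun x => ∫ t in Iic x, ψ t) = ψ := funext fun x => (hderiv x).deriv
  obtain ⟨c, d, hcd, hcd'⟩ :=
    exists_Icc_of_isCompact_subset_Ioo hψ.hasCompactSupport.isCompact hψ.tsupport_subset
  have hψ0 : ∀ t, t ∉ Icc c d → ψ t = 0 := fun t ht =>
    image_eq_zero_of_notMem_tsupport fun h => ht (hcd h)
  have hsupp : tsupport (fun x => ∫ t in Iic x, ψ t) ⊆ Icc c d := by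
    refine closure_minimal (fun x hx => ?_) isClosed_Icc
    by_contra hxcd
    refine hx ?_
    rcases lt_or_ge x c with hxc | hxc
    · exact setIntegral_eq_zero_of_forall_eq_zero fun t ht =>
        hψ0 t fun h => (h.1.trans ht).not_gt hxc
    · rw [← h0]
      exact setIntegral_eq_integral_of_forall_compl_eq_zero fun t ht =>
        hψ0 t fun h => hxcd ⟨hxc, (not_le.1 ht).le.trans h.2⟩
  refine ⟨_, ⟨?_, .of_support_subset_isCompact isCompact_Icc ((subset_tsupport _).trans hsupp),
    hsupp.trans hcd'⟩, hderiv_eq⟩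
  rw [contDiff_infty_iff_deriv, hderiv_eq]
  exact ⟨fun x => (hderiv x).differentiableAt, hψ.contDiff⟩

/-- The du Bois-Reymond lemma. -/
theorem IsWeakDerivOn.ae_eq_const [CompleteSpace E] (hab : a < b) {f : ℝ → E}
    (hf : IntegrableOn f (Ioo a b)) (h : IsWeakDerivOn f 0 (Ioo a b)) :
    ∃ c : E, ∀ᵐ t ∂volume.restrict (Ioo a b), f t = c := by
  obtain ⟨ρ, hρ, hρ1⟩ := exists_isTestOn_integral_eq_one hab
  set c : E := ∫ t in Ioo a b, ρ t • f t
  have hfc : IntegrableOn (fun t => f t - c) (Ioo a b) := hf.sub (integrableOn_const (by simp))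
  have key : ∀ ψ, IsTestOn (Ioo a b) ψ → ∫ t in Ioo a b, ψ t • (f t - c) = 0 := fun ψ hψ => by
    have hχ := hψ.sub_const_mul hρ (∫ t, ψ t)
    obtain ⟨φ, hφ, hφψ⟩ := hχ.exists_deriv_eq (by
      rw [integral_sub hψ.integrable (hρ.integrable.const_mul _), integral_const_mul, hρ1, mul_one,
        sub_self])
    have := h φ hφ
    simp only [hφψ, sub_smul, mul_smul, Pi.zero_apply, smul_zero, integral_zero, neg_zero] at this
    have hρf : IntegrableOn (fun t => (∫ s, ψ s) • ρ t • f t) (Ioo a b) :=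
      (hρ.integrable_smul hf).smul _
    rw [integral_sub (hψ.integrable_smul hf) hρf, integral_smul] at this
    simp only [smul_sub]
    rw [integral_sub (hψ.integrable_smul hf) (hψ.integrable.integrableOn.smul_const c),
      integral_smul_const, hψ.setIntegral_eq, this]
  refine ⟨c, ?_⟩
  rw [ae_restrict_iff' measurableSet_Ioo]
  refine (isOpen_Ioo.ae_eq_zero_of_integral_contDiff_smul_eq_zero
    hfc.locallyIntegrableOn fun ψ hψ hψc hψs => ?_).mono fun t ht ht' => sub_eq_zero.1 (ht ht')
  rw [← key ψ ⟨hψ, hψc, hψs⟩]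
  refine (setIntegral_eq_integral_of_forall_compl_eq_zero fun t ht => ?_).symm
  rw [image_eq_zero_of_notMem_tsupport fun h => ht (hψs h), zero_smul]

theorem integral_deriv_smul_primitive [CompleteSpace E] (hab : a ≤ b) (c : E) {g : ℝ → E}
    (hg : IntervalIntegrable g volume a b) {φ : ℝ → ℝ} (hφ : ContDiff ℝ ∞ φ) :
    (∫ t in a..b, deriv φ t • (c + ∫ r in a..t, g r)) =
      φ b • (c + ∫ r in a..b, g r) - φ a • c - ∫ t in a..b, φ t • g t := by
  have hφc : Continuous (deriv φ) := hφ.continuous_deriv (by simp)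
  have hφt : ∀ t, φ a + ∫ r in a..t, deriv φ r = φ t := fun t => by
    rw [intervalIntegral.integral_deriv_eq_sub (fun x _ => hφ.differentiable (by simp) x)
      (hφc.intervalIntegrable _ _), add_sub_cancel]
  have hdi : IntervalIntegrable (deriv φ) volume a b := hφc.intervalIntegrable a b
  have hparts := integral_bilin_primitive (ContinuousLinearMap.lsmul ℝ ℝ : ℝ →L[ℝ] E →L[ℝ] E)
    hab (φ a) c hdi hg
  simp only [hφt, ContinuousLinearMap.lsmul_apply] at hparts
  rw [eq_sub_iff_add_eq, ← hparts, intervalIntegral.integral_add]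
  · exact intervalIntegrable_bilin_left (ContinuousLinearMap.lsmul ℝ ℝ : ℝ →L[ℝ] E →L[ℝ] E) hab
      hdi (continuousOn_const.add (continuousOn_primitive hab hg))
  · exact intervalIntegrable_bilin_left (ContinuousLinearMap.lsmul ℝ ℝ : ℝ →L[ℝ] E →L[ℝ] E).flip
      hab hg hφ.continuous.continuousOn

theorem isWeakDerivOn_primitive [CompleteSpace E] (hab : a ≤ b) (c : E) {g : ℝ → E}
    (hg : IntervalIntegrable g volume a b) :
    IsWeakDerivOn (fun t => c + ∫ r in a..t, g r) g (Ioo a b) := fun φ hφ => by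
  simpa only [hφ.eq_zero left_notMem_Ioo, hφ.eq_zero right_notMem_Ioo, zero_smul, sub_zero,
    zero_sub, intervalIntegral.integral_of_le hab, integral_Ioc_eq_integral_Ioo]
    using integral_deriv_smul_primitive hab c hg hφ.contDiff

theorem IsWeakDerivOn.ae_eq_primitive [CompleteSpace E] (hab : a < b) {f g : ℝ → E}
    (hf : IntegrableOn f (Ioo a b)) (hg : IntervalIntegrable g volume a b)
    (h : IsWeakDerivOn f g (Ioo a b)) :
    ∃ c : E, ∀ᵐ t ∂volume.restrict (Ioo a b), f t = c + ∫ r in a..t, g r := by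
  have hprim : IntegrableOn (fun t => (0 : E) + ∫ r in a..t, g r) (Ioo a b) := by
    simp only [zero_add]
    exact (continuousOn_primitive hab.le hg).integrableOn_Icc.mono_set Ioo_subset_Icc_self
  have hzero : IsWeakDerivOn (fun t => f t - ((0 : E) + ∫ r in a..t, g r)) 0 (Ioo a b) :=
    fun φ hφ => by
      simp only [smul_sub]
      rw [integral_sub (hφ.deriv.integrable_smul hf) (hφ.deriv.integrable_smul hprim), h φ hφ,
        isWeakDerivOn_primitive hab.le 0 hg φ hφ]
      simp
  obtain ⟨c, hc⟩ := hzero.ae_eq_const hab (Integrable.sub hf hprim)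
  refine ⟨c, hc.mono fun t ht => ?_⟩
  rw [← ht, Pi.sub_apply, zero_add, sub_add_cancel]

end WeakDerivative

section Circle

variable {E F G : Type*} [NormedAddCommGroup E] [NormedAddCommGroup F] [NormedAddCommGroup G]

theorem measurePreserving_coe_circle :
    MeasurePreserving ((↑) : ℝ → UnitAddCircle) (volume.restrict (Ioo 0 1)) volume := by
  simpa only [zero_add, restrict_Ioo_eq_restrict_Ioc] using UnitAddCircle.measurePreserving_mk 0

theorem measurePreserving_equivIoc_circle :
    MeasurePreserving (fun x => (AddCircle.equivIoc (1 : ℝ) 0 x : ℝ)) volume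
      (volume.restrict (Ioo 0 1)) := by
  simpa only [zero_add, restrict_Ioo_eq_restrict_Ioc] using!
    (measurePreserving_subtype_coe (μa := (volume : Measure ℝ))
      (measurableSet_Ioc (a := (0 : ℝ)) (b := 0 + 1))).comp
      (AddCircle.measurePreserving_equivIoc 1 (a := 0))

theorem coe_equivIoc_circle (x : UnitAddCircle) :
    ((AddCircle.equivIoc (1 : ℝ) 0 x : ℝ) : UnitAddCircle) = x :=
  (AddCircle.equivIoc (1 : ℝ) 0).symm_apply_apply x

theorem ae_circle_iff {P : UnitAddCircle → Prop} :
    (∀ᵐ x, P x) ↔ ∀ᵐ s : ℝ ∂volume.restrict (Ioo 0 1), P s :=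
  ⟨measurePreserving_coe_circle.quasiMeasurePreserving.ae, fun h =>
    (measurePreserving_equivIoc_circle.quasiMeasurePreserving.ae h).mono fun x hx =>
      coe_equivIoc_circle x ▸ hx⟩

theorem integrable_circle_iff {f : UnitAddCircle → E} :
    Integrable f ↔ IntegrableOn (fun s : ℝ => f s) (Ioo 0 1) :=
  ⟨measurePreserving_coe_circle.integrable_comp_of_integrable, fun h => by
    simpa only [Function.comp_def, coe_equivIoc_circle] using
      measurePreserving_equivIoc_circle.integrable_comp_of_integrable h⟩

variable [NormedSpace ℝ E] [NormedSpace ℝ F] [NormedSpace ℝ G]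

theorem integral_circle (f : UnitAddCircle → E) : ∫ x, f x = ∫ s in Ioo (0 : ℝ) 1, f s := by
  simpa only [zero_add, restrict_Ioo_eq_restrict_Ioc] using
    (UnitAddCircle.integral_preimage 0 f).symm

/-- `f` agrees almost everywhere with an absolutely continuous function on the circle whose
derivative is `g`. The vanishing mean of `g` expresses that the primitive of `g` is periodic. -/
structure IsAbsCont (f g : UnitAddCircle → E) : Prop where
  intervalIntegrable : IntervalIntegrable (fun s : ℝ => g s) volume 0 1
  integral_eq_zero : ∫ s in (0 : ℝ)..1, g s = 0
  exists_primitive : ∃ c : E, ∀ᵐ s : ℝ ∂volume.restrict (Ioo 0 1),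
    f s = c + ∫ r in (0 : ℝ)..s, g r

namespace IsAbsCont

theorem congr {f f' g g' : UnitAddCircle → E} (h : IsAbsCont f g) (hf : f =ᵐ[volume] f')
    (hg : g =ᵐ[volume] g') : IsAbsCont f' g' := by
  have hg' := ae_circle_iff.1 hg
  refine ⟨intervalIntegrable_congr_ae_Ioo zero_le_one hg' h.intervalIntegrable,
    (integral_congr_ae_Ioo hg' (right_mem_Icc.2 zero_le_one)).symm.trans h.integral_eq_zero, ?_⟩
  obtain ⟨c, hc⟩ := h.exists_primitive
  refine ⟨c, ?_⟩
  filter_upwards [hc, ae_circle_iff.1 hf, ae_restrict_mem measurableSet_Ioo] with s hs hfs hs01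
  rw [← hfs, hs, integral_congr_ae_Ioo hg' (Ioo_subset_Icc_self hs01)]

theorem integral_circle_eq_zero {f g : UnitAddCircle → E} (h : IsAbsCont f g) : ∫ x, g x = 0 := by
  rw [integral_circle, ← integral_Ioc_eq_integral_Ioo,
    ← intervalIntegral.integral_of_le zero_le_one, h.integral_eq_zero]

theorem integrable {f g : UnitAddCircle → E} (h : IsAbsCont f g) : Integrable f := by
  obtain ⟨c, hc⟩ := h.exists_primitive
  rw [integrable_circle_iff]
  refine IntegrableOn.congr_fun_ae (f := fun s : ℝ => c + ∫ r in (0 : ℝ)..s, g r) ?_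
    (hc.mono fun _ hs => hs.symm)
  exact (continuousOn_const.add (continuousOn_primitive zero_le_one
    h.intervalIntegrable)).integrableOn_Icc.mono_set Ioo_subset_Icc_self

theorem norm_le {f g : UnitAddCircle → E} (h : IsAbsCont f g) :
    ∀ᵐ x, ‖f x‖ ≤ (∫ x, ‖f x‖) + ∫ x, ‖g x‖ := by
  obtain ⟨c, hc⟩ := h.exists_primitive
  have hint := fun {s t : ℝ} (hs : s ∈ Ioo (0 : ℝ) 1) (ht : t ∈ Ioo (0 : ℝ) 1) =>
    intervalIntegrable_mono h.intervalIntegrable (Ioo_subset_Icc_self hs) (Ioo_subset_Icc_self ht)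
  have hdiff : ∀ s ∈ Ioo (0 : ℝ) 1, ∀ t ∈ Ioo (0 : ℝ) 1,
      ‖∫ r in t..s, g r‖ ≤ ∫ x, ‖g x‖ := fun s hs t ht => by
    rw [integral_circle, ← integral_Ioc_eq_integral_Ioo]
    exact intervalIntegral.norm_integral_le_integral_norm_uIoc.trans
      (setIntegral_mono_set h.intervalIntegrable.1.norm (ae_of_all _ fun _ => norm_nonneg _)
        (Ioc_subset_Ioc (le_min ht.1.le hs.1.le) (max_le ht.2.le hs.2.le)).eventuallyLE)
  rw [ae_circle_iff]
  filter_upwards [hc, ae_restrict_mem measurableSet_Ioo] with s hfs hs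
  have hle : ∀ᵐ y, ‖f s‖ ≤ ‖f y‖ + ∫ x, ‖g x‖ := by
    rw [ae_circle_iff]
    filter_upwards [hc, ae_restrict_mem measurableSet_Ioo] with t hft ht
    have hfst : f s = f t + ∫ r in t..s, g r := by
      rw [hfs, hft, add_assoc, intervalIntegral.integral_add_adjacent_intervals
        (intervalIntegrable_mono h.intervalIntegrable (left_mem_Icc.2 zero_le_one)
          (Ioo_subset_Icc_self ht)) (hint ht hs)]
    rw [hfst]
    exact (norm_add_le _ _).trans (by gcongr; exact hdiff s hs t ht)
  simpa [integral_add h.integrable.norm (integrable_const _), UnitAddCircle.measure_univ,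
    measureReal_def] using
    integral_mono_ae (integrable_const _) (h.integrable.norm.add (integrable_const _)) hle

theorem bilin [CompleteSpace E] [CompleteSpace F] [CompleteSpace G] (B : E →L[ℝ] F →L[ℝ] G)
    {f g : UnitAddCircle → E} {h k : UnitAddCircle → F} (hf : IsAbsCont f g)
    (hh : IsAbsCont h k) :
    IsAbsCont (fun x => B (f x) (h x)) (fun x => B (g x) (h x) + B (f x) (k x)) := by
  obtain ⟨hg, hg0, u, hu⟩ := hf
  obtain ⟨hk, hk0, v, hv⟩ := hh
  have hprod : ∀ᵐ s : ℝ ∂volume.restrict (Ioo 0 1),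
      B (g s) (v + ∫ r in (0 : ℝ)..s, k r) + B (u + ∫ r in (0 : ℝ)..s, g r) (k s) =
        B (g s) (h s) + B (f s) (k s) := by
    filter_upwards [hu, hv] with s hus hvs
    rw [hus, hvs]
  have hparts : ∀ s ∈ Icc (0 : ℝ) 1, ∫ r in (0 : ℝ)..s, (B (g r) (h r) + B (f r) (k r)) =
      B (u + ∫ r in (0 : ℝ)..s, g r) (v + ∫ r in (0 : ℝ)..s, k r) - B u v := fun s hs => by
    have h0 : (0 : ℝ) ∈ Icc (0 : ℝ) 1 := left_mem_Icc.2 zero_le_one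
    rw [← integral_congr_ae_Ioo hprod hs, integral_bilin_primitive B hs.1 u v
      (intervalIntegrable_mono hg h0 hs) (intervalIntegrable_mono hk h0 hs)]
  refine ⟨intervalIntegrable_congr_ae_Ioo zero_le_one hprod (.add ?_ ?_), ?_, B u v, ?_⟩
  · exact intervalIntegrable_bilin_left B zero_le_one hg
      (continuousOn_const.add (continuousOn_primitive zero_le_one hk))
  · exact intervalIntegrable_bilin_left B.flip zero_le_one hk
      (continuousOn_const.add (continuousOn_primitive zero_le_one hg))
  · rw [hparts 1 (right_mem_Icc.2 zero_le_one), hg0, hk0, add_zero, add_zero, sub_self]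
  · filter_upwards [hu, hv, ae_restrict_mem measurableSet_Ioo] with s hus hvs hs
    rw [hparts s (Ioo_subset_Icc_self hs), hus, hvs, add_sub_cancel]

end IsAbsCont

/-- The `1`-periodic function that agrees with `φ` on `(0, 1]`. -/
def periodize (φ : ℝ → ℝ) : UnitAddCircle → ℝ := AddCircle.liftIoc 1 0 φ

theorem periodize_coe {φ : ℝ → ℝ} {s : ℝ} (hs : s ∈ Ioc (0 : ℝ) 1) : periodize φ s = φ s :=
  AddCircle.liftIoc_zero_coe_apply hs

theorem circDeriv_periodize {φ : ℝ → ℝ} {s : ℝ} (hs : s ∈ Ioo (0 : ℝ) 1) :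
    circDeriv (periodize φ) s = deriv φ s := by
  rw [circDeriv_coe]
  refine EventuallyEq.deriv_eq ?_
  filter_upwards [isOpen_Ioo.mem_nhds hs] with t ht using periodize_coe (Ioo_subset_Ioc_self ht)

theorem IsTestOn.isTest_periodize {φ : ℝ → ℝ} (hφ : IsTestOn (Ioo 0 1) φ) :
    IsTest (periodize φ) := by
  have hshift : ∀ (t : ℝ) (n : ℤ), periodize φ ((t - n : ℝ) : UnitAddCircle) = periodize φ t :=
    fun t n => by
      have hn : ((n : ℝ) : UnitAddCircle) = 0 := (AddCircle.coe_eq_zero_iff 1).2 ⟨n, by simp⟩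
      rw [AddCircle.coe_sub, hn, sub_zero]
  have hsum : ∀ t ∈ Ioo (0 : ℝ) 2, periodize φ t = φ t + φ (t - 1) := fun t ht => by
    rcases le_or_gt t 1 with ht1 | ht1
    · rw [periodize_coe ⟨ht.1, ht1⟩, hφ.eq_zero (x := t - 1) fun h => by linarith [h.1], add_zero]
    · have hshift_one : periodize φ ((t - 1 : ℝ) : UnitAddCircle) = periodize φ t := by
        simpa only [Int.cast_one] using hshift t 1
      rw [hφ.eq_zero (x := t) fun h => ht1.not_gt h.2, zero_add, ← hshift_one,
        periodize_coe ⟨by linarith, by linarith [ht.2]⟩]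
  have hloc : ∀ s ∈ Ioo (0 : ℝ) 2, ContDiffAt ℝ ∞ (fun s : ℝ => periodize φ s) s := fun s hs => by
    have hsmooth : ContDiff ℝ ∞ fun t => φ t + φ (t - 1) :=
      hφ.contDiff.add (hφ.contDiff.comp (contDiff_id.sub contDiff_const))
    refine hsmooth.contDiffAt.congr_of_eventuallyEq ?_
    filter_upwards [isOpen_Ioo.mem_nhds hs] with t ht using hsum t ht
  refine contDiff_iff_contDiffAt.2 fun s => ?_
  have hs : s - (⌈s⌉ - 1 : ℤ) ∈ Ioo (0 : ℝ) 2 := by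
    push_cast
    exact ⟨by linarith [Int.ceil_lt_add_one s], by linarith [Int.le_ceil s]⟩
  have hcomp : ContDiffAt ℝ ∞ ((fun t : ℝ => periodize φ t) ∘ fun t : ℝ => t - (⌈s⌉ - 1 : ℤ)) s :=
    ContDiffAt.comp s (hloc _ hs) (contDiffAt_id.sub contDiffAt_const)
  exact hcomp.congr_of_eventuallyEq (Eventually.of_forall fun t => (hshift t _).symm)

theorem IsAbsCont.isWeakDeriv {f g : L2} (h : IsAbsCont f g) : IsWeakDeriv f g := fun φ hφ => by
  obtain ⟨hg, hg0, c, hc⟩ := h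
  have hperiodic : φ (1 : ℝ) = φ (0 : ℝ) := by rw [AddCircle.coe_period, AddCircle.coe_zero]
  have hparts := integral_deriv_smul_primitive zero_le_one c hg hφ
  rw [hg0, hperiodic, add_zero, sub_self, zero_sub, intervalIntegral.integral_of_le zero_le_one,
    intervalIntegral.integral_of_le zero_le_one, integral_Ioc_eq_integral_Ioo,
    integral_Ioc_eq_integral_Ioo] at hparts
  rw [integral_circle, integral_circle, ← hparts]
  refine integral_congr_ae (hc.mono fun s hs => ?_)
  simp only [hs, circDeriv_coe]

theorem IsWeakDeriv.isWeakDerivOn {f g : L2} (h : IsWeakDeriv f g) :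
    IsWeakDerivOn (fun s : ℝ => f s) (fun s : ℝ => g s) (Ioo 0 1) := fun φ hφ => by
  have hderiv : ∫ s in Ioo 0 1, deriv φ s • f s = ∫ x, circDeriv (periodize φ) x • f x := by
    rw [integral_circle]
    exact setIntegral_congr_fun measurableSet_Ioo fun s hs => by
      simp only [circDeriv_periodize hs]
  have hval : ∫ s in Ioo 0 1, φ s • g s = ∫ x, periodize φ x • g x := by
    rw [integral_circle]
    exact setIntegral_congr_fun measurableSet_Ioo fun s hs => by
      simp only [periodize_coe (Ioo_subset_Ioc_self hs)]
  rw [hderiv, hval]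
  exact h _ hφ.isTest_periodize

theorem IsWeakDeriv.integral_eq_zero {f g : L2} (h : IsWeakDeriv f g) : ∫ x, g x = 0 := by
  have hconst : circDeriv (fun _ => (1 : ℝ)) = 0 := funext fun x => by simp [circDeriv]
  simpa [hconst] using h (fun _ => 1) contDiff_const

theorem IsWeakDeriv.isAbsCont {f g : L2} (h : IsWeakDeriv f g) : IsAbsCont f g := by
  have hint : ∀ f : L2, IntegrableOn (fun s : ℝ => f s) (Ioo 0 1) := fun f =>
    integrable_circle_iff.1 ((Lp.memLp f).integrable one_le_two)
  have hg := (intervalIntegrable_iff_integrableOn_Ioo_of_le zero_le_one).2 (hint g)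
  refine ⟨hg, ?_, h.isWeakDerivOn.ae_eq_primitive zero_lt_one (hint f) hg⟩
  rw [intervalIntegral.integral_of_le zero_le_one, integral_Ioc_eq_integral_Ioo, ← integral_circle,
    h.integral_eq_zero]

theorem isAbsCont_der {k : ℕ} (u : H k) (j : Fin k) :
    IsAbsCont (der u j.castSucc) (der u j.succ) :=
  (u.2 j).isAbsCont

theorem chordArc_le_norm_deriv {c : UnitAddCircle → Plane} {s : ℝ} {v : Plane}
    (h : HasDerivAt (fun s : ℝ => c s) v s) : chordArc c ≤ ‖v‖ := by
  refine ge_of_tendsto (hasDerivAt_iff_tendsto_slope.1 h).norm ?_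
  filter_upwards [mem_nhdsWithin_of_mem_nhds (Metric.ball_mem_nhds s one_half_pos),
    self_mem_nhdsWithin] with t ht hts
  have hdist : dist (t : UnitAddCircle) s = |t - s| := by
    rw [dist_eq_norm, ← AddCircle.coe_sub, AddCircle.norm_coe_eq_abs_iff 1 one_ne_zero, abs_one]
    exact (Metric.mem_ball.1 ht).le
  have hne : (t : UnitAddCircle) ≠ s := by
    rw [← dist_pos, hdist]
    exact abs_pos.2 (sub_ne_zero.2 hts)
  calc chordArc c ≤ ‖c t - c s‖ / dist (t : UnitAddCircle) s :=
        ciInf_le (f := fun p : {p : UnitAddCircle × UnitAddCircle // p.1 ≠ p.2} =>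
          ‖c p.1.1 - c p.1.2‖ / dist p.1.1 p.1.2)
          ⟨0, by rintro _ ⟨p, rfl⟩; positivity⟩ ⟨(t, s), hne⟩
    _ = ‖slope (fun s : ℝ => c s) s t‖ := by
        rw [hdist, slope_def_module, norm_smul, norm_inv, Real.norm_eq_abs, div_eq_inv_mul]

theorem IsAbsCont.ae_hasDerivAt [CompleteSpace E] {c g : UnitAddCircle → E} (hc : Continuous c)
    (h : IsAbsCont c g) :
    ∀ᵐ s : ℝ ∂volume.restrict (Ioo 0 1), HasDerivAt (fun s : ℝ => c s) (g s) s := by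
  obtain ⟨hg, -, c₀, hc₀⟩ := h
  have heq : EqOn (fun s : ℝ => c s) (fun s => c₀ + ∫ r in (0 : ℝ)..s, g r) (Ioo 0 1) :=
    Measure.eqOn_open_of_ae_eq hc₀ isOpen_Ioo
      (hc.comp (AddCircle.continuous_mk' 1)).continuousOn
      ((continuousOn_const.add (continuousOn_primitive zero_le_one hg)).mono Ioo_subset_Icc_self)
  filter_upwards [ae_restrict_of_ae hg.ae_hasDerivAt_integral, ae_restrict_mem measurableSet_Ioo]
    with s hderiv hs
  refine ((hderiv (Icc_subset_uIcc (Ioo_subset_Icc_self hs)) 0 left_mem_uIcc).const_add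
    c₀).congr_of_eventuallyEq ?_
  filter_upwards [isOpen_Ioo.mem_nhds hs] with t ht using heq ht

theorem exists_speed_lower_bound_of_mem_V {η : H 2} (hη : η ∈ V) :
    ∃ κ : ℝ, 0 < κ ∧ ∀ᵐ x, κ ≤ ‖der η 1 x‖ := by
  obtain ⟨c, hc, hpos⟩ := hη
  refine ⟨chordArc c, hpos, ae_circle_iff.2 ?_⟩
  have habs : IsAbsCont c (der η 1) := (isAbsCont_der η 0).congr hc.symm .rfl
  exact (habs.ae_hasDerivAt c.continuous).mono fun s hs => chordArc_le_norm_deriv hs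

end Circle

section Abstract

theorem exists_inverse_of_commute_of_norm_le {L : Type*} [NormedAddCommGroup L] [NormedSpace ℝ L]
    [CompleteSpace L] {S R : L →L[ℝ] L} {C : ℝ} (hRinj : Function.Injective R)
    (hSR : Commute S R) (hdense : DenseRange S) (hle : ∀ x, ‖R x‖ ≤ C * ‖S x‖) :
    ∃ P : L →L[ℝ] L, ∀ g p, S p = R g ↔ p = P g := by
  set P : L →L[ℝ] L := R.toLinearMap.extendOfNorm S.toLinearMap
  have hPS : ∀ x, P (S x) = R x := LinearMap.extendOfNorm_eq hdense ⟨C, hle⟩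
  have hcomm : ∀ x, S (R x) = R (S x) := fun x => congr($hSR.eq x)
  have hSP : ∀ g, S (P g) = R g := congrFun <| hdense.equalizer (by fun_prop) (by fun_prop) <|
    funext fun x => by simp only [Function.comp_apply, hPS, hcomm]
  have hRP : ∀ g, R (P g) = P (R g) := congrFun <| hdense.equalizer (by fun_prop) (by fun_prop) <|
    funext fun x => by simp only [Function.comp_apply, hPS, ← hcomm]
  refine ⟨P, fun g p => ⟨fun h => hRinj ?_, fun h => h ▸ hSP g⟩⟩
  rw [hRP, ← h, hPS]

variable {L : Type*} [NormedAddCommGroup L] [InnerProductSpace ℝ L] {G R S J : L →L[ℝ] L} {κ : ℝ}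

theorem smul_one_le_of_mul_norm_sq_le_inner (hG : G.IsSymmetric)
    (h : ∀ x, κ * ‖x‖ ^ 2 ≤ inner ℝ (G x) x) : κ • 1 ≤ G := by
  refine (ContinuousLinearMap.le_def _ _).2 ((ContinuousLinearMap.isPositive_iff _).2 ⟨?_, ?_⟩)
  · exact hG.sub (LinearMap.IsSymmetric.id.smul (RCLike.conj_to_real))
  · intro x
    simpa [inner_sub_left, real_inner_smul_left] using h x

theorem mul_norm_sq_le_inner_of_smul_one_le (hG : κ • 1 ≤ G) (x : L) :
    κ * ‖x‖ ^ 2 ≤ inner ℝ (G x) x := by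
  have h := ((ContinuousLinearMap.le_def _ _).1 hG).inner_nonneg_left x
  simpa [inner_sub_left, real_inner_smul_left] using h

theorem inner_comm_of_smul_one_le (hG : κ • 1 ≤ G) (x y : L) :
    inner ℝ (G x) y = inner ℝ x (G y) := by
  have h := ((ContinuousLinearMap.le_def _ _).1 hG).inner_left_eq_inner_right x y
  simpa [inner_sub_left, inner_sub_right, real_inner_smul_left, real_inner_smul_right] using h

theorem norm_le_of_mul_norm_sq_le_inner (hκ : 0 < κ)
    (hRS : ∀ x, κ * ‖R x‖ ^ 2 ≤ inner ℝ (G (R x)) (S x)) (x : L) :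
    ‖R x‖ ≤ ‖G‖ / κ * ‖S x‖ := by
  rw [div_mul_eq_mul_div, le_div_iff₀ hκ]
  have hle : κ * ‖R x‖ ^ 2 ≤ ‖G‖ * ‖R x‖ * ‖S x‖ :=
    (hRS x).trans ((real_inner_le_norm _ _).trans (by gcongr; exact G.le_opNorm _))
  rcases (norm_nonneg (R x)).eq_or_lt with h0 | hpos
  · rw [← h0, zero_mul]
    positivity
  · nlinarith

variable [CompleteSpace L]

theorem isUnit_of_smul_one_le (hκ : 0 < κ) (hG : κ • 1 ≤ G) : IsUnit G := by
  lift κ to NNReal using hκ.le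
  refine G.isUnit_of_forall_le_norm_inner_map (NNReal.coe_pos.1 hκ) fun x => ?_
  rw [mul_comm]
  exact (mul_norm_sq_le_inner_of_smul_one_le hG x).trans (le_abs_self _)

theorem inner_map_comm_of_isSelfAdjoint_mul (hG : κ • 1 ≤ G) (hGR : IsSelfAdjoint (G * R))
    (x y : L) : inner ℝ (G x) (R y) = inner ℝ (G (R x)) y := by
  rw [inner_comm_of_smul_one_le hG]
  exact (hGR.isSymmetric x y).symm

theorem denseRange_of_mul_norm_sq_le_inner (hκ : 0 < κ) (hG : κ • 1 ≤ G)
    (hGR : IsSelfAdjoint (G * R)) (hRinj : Function.Injective R) (hSR : Commute S R)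
    (hRS : ∀ x, κ * ‖R x‖ ^ 2 ≤ inner ℝ (G (R x)) (S x)) : DenseRange S := by
  suffices S.range.topologicalClosure = ⊤ from Submodule.dense_iff_topologicalClosure_eq_top.2 this
  rw [Submodule.topologicalClosure_eq_top_iff, Submodule.eq_bot_iff]
  intro z hz
  obtain ⟨w, rfl⟩ := (ContinuousLinearMap.isUnit_iff_bijective.1 (isUnit_of_smul_one_le hκ hG)).2 z
  have hcomm : S (R w) = R (S w) := congr($hSR.eq w)
  have horth : inner ℝ (G (R w)) (S w) = 0 := by
    rw [← inner_map_comm_of_isSelfAdjoint_mul hG hGR, ← hcomm, real_inner_comm]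
    exact hz _ ⟨R w, rfl⟩
  have hRw : R w = 0 := by
    have hle := hRS w
    rw [horth] at hle
    exact norm_eq_zero.1 (pow_eq_zero_iff two_ne_zero |>.1
      ((nonpos_of_mul_nonpos_right hle hκ).antisymm (sq_nonneg _)))
  rw [hRinj (hRw.trans (map_zero R).symm), map_zero]

theorem exists_solution_of_commute (hκ : 0 < κ) (hG : κ • 1 ≤ G)
    (hGR : IsSelfAdjoint (G * R)) (hRinj : Function.Injective R) (hJR : Commute J R)
    (hJ : ∀ x, 0 ≤ inner ℝ (G (R x) - G (R (R x))) (J x)) :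
    ∃ P : L →L[ℝ] L, ∀ g p, J p = R (J p + g - p) ↔ p = P g := by
  -- The equation reads `S p = R g`.
  set S : L →L[ℝ] L := R + J - R * J with hS
  have hSR : Commute S R :=
    ((Commute.refl R).add_left hJR).sub_left ((Commute.refl R).mul_left hJR)
  have hRS : ∀ x, κ * ‖R x‖ ^ 2 ≤ inner ℝ (G (R x)) (S x) := fun x => by
    have hSx : inner ℝ (G (R x)) (S x) =
        inner ℝ (G (R x)) (R x) + inner ℝ (G (R x) - G (R (R x))) (J x) := by
      simp only [hS, sub_apply, add_apply, mul_apply_eq_comp, inner_sub_left, inner_sub_right,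
        inner_add_right, inner_map_comm_of_isSelfAdjoint_mul hG hGR (R x)]
      ring
    rw [hSx]
    exact le_add_of_le_of_nonneg (mul_norm_sq_le_inner_of_smul_one_le hG _) (hJ x)
  obtain ⟨P, hP⟩ := exists_inverse_of_commute_of_norm_le hRinj hSR
    (denseRange_of_mul_norm_sq_le_inner hκ hG hGR hRinj hSR hRS)
    (norm_le_of_mul_norm_sq_le_inner hκ hRS)
  refine ⟨P, fun g p => Iff.trans ?_ (hP g p)⟩
  simp only [hS, sub_apply, add_apply, mul_apply_eq_comp, map_sub, map_add]
  grind

end Abstract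

section Lp

variable {α : Type*} [MeasurableSpace α] (μ : Measure α)

theorem integral_norm_le [IsFiniteMeasure μ] {E : Type*} [NormedAddCommGroup E] (f : Lp E 2 μ) :
    ∫ x, ‖f x‖ ∂μ ≤ μ.real univ ^ (1 / 2 : ℝ) * ‖f‖ := by
  have hf := (Lp.memLp f).aestronglyMeasurable
  rw [integral_norm_eq_lintegral_enorm hf, ← eLpNorm_one_eq_lintegral_enorm, Lp.norm_def,
    measureReal_def, ENNReal.toReal_rpow, mul_comm, ← ENNReal.toReal_mul]
  have hexp : (1 / 2 : ℝ) = 1 / (1 : ℝ≥0∞).toReal - 1 / (2 : ℝ≥0∞).toReal := by norm_num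
  rw [hexp]
  refine ENNReal.toReal_mono (ENNReal.mul_ne_top (Lp.eLpNorm_ne_top f) ?_)
    (eLpNorm_le_eLpNorm_mul_rpow_measure_univ one_le_two hf)
  exact ENNReal.rpow_ne_top_of_nonneg (by norm_num) (measure_ne_top _ _)

section Normed

variable {X : Type*} [NormedAddCommGroup X] [NormedSpace ℝ X]

/-- The pointwise action of bounded operators on `X` upon square integrable functions with values
in `X`. -/
def compLpAlgHom : (X →L[ℝ] X) →ₐ[ℝ] (Lp X 2 μ →L[ℝ] Lp X 2 μ) :=
  AlgHom.ofLinearMap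
    { toFun := fun B => B.compLpL 2 μ
      map_add' := ContinuousLinearMap.add_compLpL
      map_smul' := fun c B => ContinuousLinearMap.smul_compLpL c B }
    (by
      ext1 f
      exact Lp.ext (ContinuousLinearMap.coeFn_compLpL _ f))
    (fun B C => by
      ext1 f
      refine Lp.ext ?_
      filter_upwards [(B * C).coeFn_compLpL (p := 2) f, C.coeFn_compLpL (p := 2) f,
        B.coeFn_compLpL (p := 2) (C.compLpL 2 μ f)] with x hBC hC hB
      exact hBC.trans ((congrArg B hC.symm).trans hB.symm))

variable {μ}

theorem coeFn_compLpAlgHom (B : X →L[ℝ] X) (f : Lp X 2 μ) :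
    ∀ᵐ x ∂μ, compLpAlgHom μ B f x = B (f x) :=
  B.coeFn_compLpL f

theorem compLpAlgHom_injective {B : X →L[ℝ] X} (hB : Function.Injective B) :
    Function.Injective (compLpAlgHom μ B) := fun f g hfg => by
  refine Lp.ext ?_
  filter_upwards [coeFn_compLpAlgHom B f, coeFn_compLpAlgHom B g] with x hf hg
  exact hB (by rw [← hf, ← hg, hfg])

theorem compLpAlgHom_add_eq_iff {B C : X →L[ℝ] X} {f g h : Lp X 2 μ} :
    compLpAlgHom μ B f + compLpAlgHom μ C g = compLpAlgHom μ B h ↔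
      ∀ᵐ x ∂μ, B (f x) + C (g x) = B (h x) := by
  rw [Lp.ext_iff]
  refine eventually_congr ?_
  filter_upwards [Lp.coeFn_add (compLpAlgHom μ B f) (compLpAlgHom μ C g), coeFn_compLpAlgHom B f,
    coeFn_compLpAlgHom C g, coeFn_compLpAlgHom B h] with x hadd hf hg hh
  rw [hadd, Pi.add_apply, hf, hg, hh]

theorem ae_eq_compLpL_of_ae_eq {Y Z : Type*} [NormedAddCommGroup Y] [NormedSpace ℝ Y]
    {B C : X →L[ℝ] X} {S : X →L[ℝ] Y} {ι : X → Z} {ι' : Y → Z}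
    (hS : ∀ x y, B x + C x = B y → ι x = ι' (S y)) {f g h : Lp X 2 μ}
    (hfgh : ∀ᵐ x ∂μ, B (f x) + C (g x) = B (h x)) :
    ∀ᵐ x ∂μ, ι (g x) = ι' (S.compLpL 2 μ (g + h - f) x) := by
  filter_upwards [hfgh, S.coeFn_compLpL (p := 2) (g + h - f), Lp.coeFn_sub (g + h) f,
    Lp.coeFn_add g h] with x hx hSx hsub hadd
  rw [hSx, hsub, Pi.sub_apply, hadd, Pi.add_apply]
  refine hS _ _ ?_
  rw [map_sub, map_add, ← hx, add_sub_assoc, add_sub_cancel_left]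

end Normed

variable {X : Type*} [NormedAddCommGroup X] [InnerProductSpace ℝ X] {μ}

theorem inner_compLpAlgHom (B : X →L[ℝ] X) (f g : Lp X 2 μ) :
    inner ℝ (compLpAlgHom μ B f) g = ∫ x, inner ℝ (B (f x)) (g x) ∂μ := by
  rw [L2.inner_def]
  refine integral_congr_ae ?_
  filter_upwards [coeFn_compLpAlgHom B f] with x hf
  rw [hf]

theorem isPositive_compLpAlgHom {B : X →L[ℝ] X} (hB : B.IsPositive) :
    (compLpAlgHom μ B).IsPositive := by
  refine (ContinuousLinearMap.isPositive_iff _).2 ⟨fun f g => ?_, fun f => ?_⟩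
  · change inner ℝ (compLpAlgHom μ B f) g = inner ℝ f (compLpAlgHom μ B g)
    rw [real_inner_comm _ f, inner_compLpAlgHom, inner_compLpAlgHom]
    exact integral_congr_ae (ae_of_all _ fun x => by
      simp only [hB.inner_left_eq_inner_right (f x), real_inner_comm])
  · rw [inner_compLpAlgHom]
    exact integral_nonneg fun x => hB.inner_nonneg_left _

theorem compLpAlgHom_mono {B C : X →L[ℝ] X} (h : B ≤ C) :
    compLpAlgHom μ B ≤ compLpAlgHom μ C := by
  rw [ContinuousLinearMap.le_def, ← map_sub]
  exact isPositive_compLpAlgHom h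

end Lp

section Time

variable {X : Type*} [NormedAddCommGroup X] {T : ℝ}

theorem intervalIntegrable_timeL2 (hT : 0 ≤ T) (f : TimeL2 T X) :
    IntervalIntegrable f volume 0 T :=
  (intervalIntegrable_iff_integrableOn_Ioo_of_le hT).2 ((Lp.memLp f).integrable one_le_two)

theorem intervalIntegrable_timeL2_of_mem (f : TimeL2 T X) {t : ℝ} (ht : t ∈ Ioo 0 T) :
    IntervalIntegrable f volume 0 t :=
  have hT := (ht.1.trans ht.2).le
  intervalIntegrable_mono (intervalIntegrable_timeL2 hT f) (left_mem_Icc.2 hT)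
    (Ioo_subset_Icc_self ht)

variable [NormedSpace ℝ X]

theorem norm_integral_timeL2_le (f : TimeL2 T X) {t : ℝ} (ht : t ∈ Ioo 0 T) :
    ‖∫ r in (0 : ℝ)..t, f r‖ ≤ (timeMeasure T).real univ ^ (1 / 2 : ℝ) * ‖f‖ := by
  refine le_trans ?_ (integral_norm_le (timeMeasure T) f)
  refine (intervalIntegral.norm_integral_le_integral_norm ht.1.le).trans ?_
  rw [intervalIntegral.integral_of_le ht.1.le]
  exact setIntegral_mono_set ((Lp.memLp f).integrable one_le_two).norm
    (ae_of_all _ fun _ => norm_nonneg _) (Ioc_subset_Ioo_right ht.2).eventuallyLE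

theorem memLp_integral_timeL2 (f : TimeL2 T X) :
    MemLp (fun t => ∫ r in (0 : ℝ)..t, f r) 2 (timeMeasure T) := by
  have hcont : ContinuousOn (fun t => ∫ r in (0 : ℝ)..t, f r) (Ioo 0 T) := fun t ht =>
    have hT := (ht.1.trans ht.2).le
    ((continuousOn_primitive hT (intervalIntegrable_timeL2 hT f)).mono Ioo_subset_Icc_self) t ht
  exact .of_bound (hcont.aestronglyMeasurable measurableSet_Ioo) _
    ((ae_restrict_mem measurableSet_Ioo).mono fun t ht => norm_integral_timeL2_le f ht)

/-- The Volterra operator `f ↦ ∫₀ᵗ f` on `L²(0,T;X)`. -/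
def timePrimitive (T : ℝ) (X : Type*) [NormedAddCommGroup X] [NormedSpace ℝ X] :
    TimeL2 T X →L[ℝ] TimeL2 T X :=
  LinearMap.mkContinuous
    { toFun := fun f => (memLp_integral_timeL2 f).toLp _
      map_add' := fun f g => by
        rw [← MemLp.toLp_add]
        refine MemLp.toLp_congr _ _ ?_
        filter_upwards [ae_restrict_mem measurableSet_Ioo] with t ht
        rw [integral_congr_ae_Ioo (Lp.coeFn_add f g) (Ioo_subset_Icc_self ht)]
        exact intervalIntegral.integral_add (intervalIntegrable_timeL2_of_mem f ht)
          (intervalIntegrable_timeL2_of_mem g ht)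
      map_smul' := fun a f => by
        rw [RingHom.id_apply, ← MemLp.toLp_const_smul]
        refine MemLp.toLp_congr _ _ ?_
        filter_upwards [ae_restrict_mem measurableSet_Ioo] with t ht
        rw [integral_congr_ae_Ioo (Lp.coeFn_smul a f) (Ioo_subset_Icc_self ht)]
        exact intervalIntegral.integral_smul a f }
    ((measureUnivNNReal (timeMeasure T) : ℝ) ^ (2 : ℝ≥0∞).toReal⁻¹ *
      (timeMeasure T).real univ ^ (1 / 2 : ℝ))
    fun f => by
      rw [mul_assoc]
      refine Lp.norm_le_of_ae_bound (by positivity) ?_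
      filter_upwards [(memLp_integral_timeL2 f).coeFn_toLp, ae_restrict_mem measurableSet_Ioo]
        with t hf ht
      exact (congrArg norm hf).trans_le (norm_integral_timeL2_le f ht)

theorem coeFn_timePrimitive (f : TimeL2 T X) :
    timePrimitive T X f =ᵐ[timeMeasure T] fun t => ∫ r in (0 : ℝ)..t, f r :=
  (memLp_integral_timeL2 f).coeFn_toLp

theorem eq_timePrimitive_iff {u f : TimeL2 T X} :
    u = timePrimitive T X f ↔ u =ᵐ[timeMeasure T] fun t => ∫ r in (0 : ℝ)..t, f r :=
  Lp.ext_iff.trans ⟨fun h => h.trans (coeFn_timePrimitive f),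
    fun h => h.trans (coeFn_timePrimitive f).symm⟩

variable [CompleteSpace X]

theorem commute_timePrimitive (B : X →L[ℝ] X) :
    Commute (timePrimitive T X) (compLpAlgHom (timeMeasure T) B) := by
  ext1 f
  refine Lp.ext ?_
  filter_upwards [coeFn_timePrimitive f, coeFn_timePrimitive (compLpAlgHom (timeMeasure T) B f),
    coeFn_compLpAlgHom B (timePrimitive T X f), ae_restrict_mem measurableSet_Ioo]
    with t hJf hJBf hBJf ht
  calc timePrimitive T X (compLpAlgHom (timeMeasure T) B f) t
      = ∫ r in (0 : ℝ)..t, B (f r) := by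
        rw [hJBf, integral_congr_ae_Ioo (coeFn_compLpAlgHom B f) (Ioo_subset_Icc_self ht)]
    _ = B (timePrimitive T X f t) := by
        rw [hJf]
        exact B.intervalIntegral_comp_comm (intervalIntegrable_timeL2_of_mem f ht)
    _ = compLpAlgHom (timeMeasure T) B (timePrimitive T X f) t := hBJf.symm

theorem mem_timeH1_iff {u p : TimeL2 T X} :
    WithLp.toLp 2 (u, p) ∈ TimeH1 T X ↔ IsWeakDerivOn u p (Ioo 0 T) :=
  ⟨fun h φ hφ => h φ hφ.contDiff hφ.hasCompactSupport hφ.tsupport_subset,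
    fun h φ hφ hc hs => h φ ⟨hφ, hc, hs⟩⟩

theorem mem_timeH1_of_ae_eq_primitive {u p : TimeL2 T X}
    (h : u =ᵐ[timeMeasure T] fun t => ∫ r in (0 : ℝ)..t, p r) :
    WithLp.toLp 2 (u, p) ∈ TimeH1 T X := by
  refine mem_timeH1_iff.2 fun φ hφ => ?_
  rcases le_or_gt T 0 with hT | hT
  · simp [Ioo_eq_empty hT.not_gt]
  rw [← isWeakDerivOn_primitive hT.le 0 (intervalIntegrable_timeL2 hT.le p) φ hφ]
  refine integral_congr_ae ?_
  filter_upwards [h] with t ht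
  rw [ht, zero_add]

theorem ae_eq_primitive_of_mem_timeH1 (hT : 0 < T) {u p : TimeL2 T X}
    (h : WithLp.toLp 2 (u, p) ∈ TimeH1 T X) {c : ℝ → X} (hc : ContinuousOn c (Icc 0 T))
    (hcu : c =ᵐ[timeMeasure T] u) (h0 : c 0 = 0) :
    u =ᵐ[timeMeasure T] fun t => ∫ r in (0 : ℝ)..t, p r := by
  have hp := intervalIntegrable_timeL2 hT.le p
  obtain ⟨a, ha⟩ := (mem_timeH1_iff.1 h).ae_eq_primitive hT
    ((Lp.memLp u).integrable one_le_two) hp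
  have heq : EqOn c (fun t => a + ∫ r in (0 : ℝ)..t, p r) (Icc 0 T) := by
    refine Measure.eqOn_Icc_of_ae_eq volume hT.ne ?_ hc
      (continuousOn_const.add (continuousOn_primitive hT.le hp))
    rw [← restrict_Ioo_eq_restrict_Icc]
    filter_upwards [hcu, ha] with t hct hut
    rw [hct, hut]
  have ha0 : a = 0 := by
    simpa [h0] using (heq (left_mem_Icc.2 hT.le)).symm
  filter_upwards [ha] with t hut
  rw [hut, ha0, zero_add]

theorem exists_continuousOn_zero_iff_ae_eq_primitive (hT : 0 < T) {u p : TimeL2 T X}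
    (h : WithLp.toLp 2 (u, p) ∈ TimeH1 T X) :
    (∃ c : ℝ → X, ContinuousOn c (Icc 0 T) ∧ c =ᵐ[timeMeasure T] u ∧ c 0 = 0) ↔
      u =ᵐ[timeMeasure T] fun t => ∫ r in (0 : ℝ)..t, p r :=
  ⟨fun ⟨_, hc, hcu, h0⟩ => ae_eq_primitive_of_mem_timeH1 hT h hc hcu h0, fun h =>
    ⟨_, continuousOn_primitive hT.le (intervalIntegrable_timeL2 hT.le p), h.symm,
      intervalIntegral.integral_same⟩⟩

end Time

section Accretive

variable {X : Type*} [NormedAddCommGroup X] [InnerProductSpace ℝ X] [CompleteSpace X] {T : ℝ}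

-- Integration by parts: `2 ∫₀ᵀ ⟪B f, ∫₀ᵗ f⟫ = ⟪B ∫₀ᵀ f, ∫₀ᵀ f⟫`.
theorem inner_compLpAlgHom_timePrimitive_nonneg {B : X →L[ℝ] X} (hB : B.IsPositive)
    (f : TimeL2 T X) : 0 ≤ inner ℝ (compLpAlgHom (timeMeasure T) B f) (timePrimitive T X f) := by
  rw [inner_compLpAlgHom]
  rcases le_or_gt T 0 with hT | hT
  · simp [Ioo_eq_empty hT.not_gt]
  let β : X →L[ℝ] X →L[ℝ] ℝ := (innerSL ℝ : X →L[ℝ] X →L[ℝ] ℝ).comp B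
  have hf := intervalIntegrable_timeL2 hT.le f
  have hparts := integral_bilin_primitive β hT.le 0 0 hf hf
  have hsymm : ∀ t, β (f t) (0 + ∫ r in (0 : ℝ)..t, f r) + β (0 + ∫ r in (0 : ℝ)..t, f r) (f t) =
      2 * inner ℝ (B (f t)) (∫ r in (0 : ℝ)..t, f r) := fun t => by
    simp only [β, zero_add, ContinuousLinearMap.comp_apply, innerSL_apply_apply,
      hB.inner_left_eq_inner_right (∫ r in (0 : ℝ)..t, f r), real_inner_comm (B (f t))]
    ring
  have hinner : ∫ t in Ioo 0 T, inner ℝ (B (f t)) (timePrimitive T X f t) =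
      ∫ t in (0 : ℝ)..T, inner ℝ (B (f t)) (∫ r in (0 : ℝ)..t, f r) := by
    rw [intervalIntegral.integral_of_le hT.le, integral_Ioc_eq_integral_Ioo]
    refine integral_congr_ae ?_
    filter_upwards [coeFn_timePrimitive f] with t ht
    rw [ht]
  simp only [hsymm, intervalIntegral.integral_const_mul, map_zero, sub_zero] at hparts
  have hnonneg := hB.inner_nonneg_left (0 + ∫ t in (0 : ℝ)..T, f t)
  rw [hinner]
  exact nonneg_of_mul_nonneg_right (hparts.symm ▸ hnonneg) two_pos

variable {M D : X →L[ℝ] X} {κ : ℝ}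

-- With `R = (M + D)⁻¹ M`, one has `M - M R = (1 - R)† M (1 - R) + R† D R`.
theorem exists_resolvent (hM : M.IsPositive) (hD : D.IsPositive) (hκ : 0 < κ)
    (hMD : κ • 1 ≤ M + D) :
    ∃ R : X →L[ℝ] X, (M + D) * R = M ∧ (M - M * R).IsPositive := by
  obtain ⟨G, hG⟩ := isUnit_of_smul_one_le hκ hMD
  set R : X →L[ℝ] X := ↑G⁻¹ * M with hR
  have hGR : (M + D) * R = M := by rw [← hG, hR, Units.mul_inv_cancel_left]
  refine ⟨R, hGR, ?_⟩
  have hDR : M * (1 - R) = D * R := by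
    rw [mul_sub, mul_one, sub_eq_iff_eq_add', ← add_mul, hGR]
  have hsum : M - M * R = star (1 - R) * (M * (1 - R)) + star R * (D * R) := by
    rw [← hDR, ← add_mul, ← star_add, sub_add_cancel, star_one, one_mul, mul_sub, mul_one]
  rw [hsum]
  exact (hM.adjoint_conj (1 - R)).add (hD.adjoint_conj R)

theorem exists_evolution_solution (hM : M.IsPositive) (hD : D.IsPositive)
    (hMinj : Function.Injective M) (hκ : 0 < κ) (hMD : κ • 1 ≤ M + D) :
    ∃ P : TimeL2 T X →L[ℝ] TimeL2 T X, ∀ g p : TimeL2 T X,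
      (∀ᵐ t ∂timeMeasure T, M (p t) + D (timePrimitive T X p t) = M (g t)) ↔ p = P g := by
  obtain ⟨R, hR, hMR⟩ := exists_resolvent hM hD hκ hMD
  have hRinj : Function.Injective R := fun x y hxy =>
    hMinj (by rw [← hR]; exact congrArg (M + D) hxy)
  set ι := compLpAlgHom (X := X) (timeMeasure T)
  have hG : κ • 1 ≤ ι (M + D) := by
    simpa only [map_smul, map_one] using compLpAlgHom_mono (μ := timeMeasure T) hMD
  have hGR : ι (M + D) * ι R = ι M := by rw [← map_mul, hR]
  have hGRx : ∀ f, ι (M + D) (ι R f) = ι M f := fun f => congr($hGR f)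
  obtain ⟨P, hP⟩ := exists_solution_of_commute (J := timePrimitive T X) hκ hG
    (hGR ▸ (isPositive_compLpAlgHom hM).isSelfAdjoint) (compLpAlgHom_injective hRinj)
    (commute_timePrimitive R) fun f => by
      rw [hGRx, hGRx]
      simpa [ι] using inner_compLpAlgHom_timePrimitive_nonneg hMR f
  refine ⟨P, fun g p => compLpAlgHom_add_eq_iff.symm.trans (Iff.trans ?_ (hP g p))⟩
  have hinj : Function.Injective (ι (M + D)) :=
    (ContinuousLinearMap.isUnit_iff_bijective.1 (isUnit_of_smul_one_le hκ hG)).1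
  change _ ↔ timePrimitive T X p = ι R (timePrimitive T X p + g - p)
  rw [← hinj.eq_iff (a := timePrimitive T X p), hGRx]
  simp only [map_add, map_sub, add_apply]
  grind

theorem exists_regular_evolution_solution {Y Z : Type*} [NormedAddCommGroup Y] [NormedSpace ℝ Y]
    (hM : M.IsPositive) (hD : D.IsPositive) (hMinj : Function.Injective M) (hκ : 0 < κ)
    (hMD : κ • 1 ≤ M + D) {S : X →L[ℝ] Y} {ι : X → Z} {ι' : Y → Z}
    (hι' : Function.Injective ι') (hS : ∀ u f, M u + D u = M f → ι u = ι' (S f)) :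
    ∃ C, 0 < C ∧ ∀ g : TimeL2 T X, ∃ (u p : TimeL2 T X) (v : TimeL2 T Y),
      ‖u‖ + ‖p‖ + ‖v‖ ≤ C * ‖g‖ ∧ ∀ (u' p' : TimeL2 T X) (v' : TimeL2 T Y),
        ((u' =ᵐ[timeMeasure T] fun t => ∫ r in (0 : ℝ)..t, p' r) ∧
          (∀ᵐ t ∂timeMeasure T, M (p' t) + D (u' t) = M (g t)) ∧
          ∀ᵐ t ∂timeMeasure T, ι (u' t) = ι' (v' t)) ↔ u' = u ∧ p' = p ∧ v' = v := by
  obtain ⟨P, hP⟩ := exists_evolution_solution (T := T) hM hD hMinj hκ hMD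
  set U := timePrimitive T X ∘L P
  set W := S.compLpL 2 (timeMeasure T) ∘L (U + 1 - P)
  have hUW : ∀ g, ∀ᵐ t ∂timeMeasure T, ι (U g t) = ι' (W g t) := fun g =>
    ae_eq_compLpL_of_ae_eq hS ((hP g _).2 rfl)
  have hbound : ∀ g, ‖U g‖ + ‖P g‖ + ‖W g‖ ≤ (‖U‖ + ‖P‖ + ‖W‖ + 1) * ‖g‖ := fun g => by
    linarith [U.le_opNorm g, P.le_opNorm g, W.le_opNorm g, norm_nonneg g]
  refine ⟨_, by positivity, fun g => ⟨U g, P g, W g, hbound g, fun u' p' v' => ?_⟩⟩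
  rw [← eq_timePrimitive_iff]
  constructor
  · rintro ⟨rfl, hp', huv⟩
    obtain rfl := (hP g p').1 hp'
    refine ⟨rfl, rfl, Lp.ext ?_⟩
    filter_upwards [huv, hUW g] with t ht htW
    exact hι' (ht.symm.trans htW)
  · rintro ⟨rfl, rfl, rfl⟩
    exact ⟨rfl, (hP g _).2 rfl, hUW g⟩

end Accretive

section Sobolev

theorem IsWeakDerivOn.unique {E : Type*} [NormedAddCommGroup E] [NormedSpace ℝ E] [CompleteSpace E]
    {U : Set ℝ} (hU : IsOpen U) {f g g' : ℝ → E} (hg : IntegrableOn g U) (hg' : IntegrableOn g' U)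
    (h : IsWeakDerivOn f g U) (h' : IsWeakDerivOn f g' U) :
    ∀ᵐ t ∂volume.restrict U, g t = g' t := by
  rw [ae_restrict_iff' hU.measurableSet]
  have hzero : ∀ᵐ t, t ∈ U → (g - g') t = 0 :=
    hU.ae_eq_zero_of_integral_contDiff_smul_eq_zero (hg.sub hg').locallyIntegrableOn
      fun φ hφ hc hs => by
        have htest : IsTestOn U φ := ⟨hφ, hc, hs⟩
        rw [← setIntegral_eq_integral_of_forall_compl_eq_zero (s := U) fun t ht => by
          rw [htest.eq_zero ht, zero_smul]]
        simp only [Pi.sub_apply, smul_sub]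
        rw [integral_sub (htest.integrable_smul hg) (htest.integrable_smul hg'), sub_eq_zero]
        exact neg_injective ((h φ htest).symm.trans (h' φ htest))
  exact hzero.mono fun t ht htU => sub_eq_zero.1 (ht htU)

theorem IsWeakDeriv.unique {f g g' : L2} (h : IsWeakDeriv f g) (h' : IsWeakDeriv f g') :
    g = g' := by
  have hint : ∀ k : L2, IntegrableOn (fun s : ℝ => k s) (Ioo 0 1) := fun k =>
    integrable_circle_iff.1 ((Lp.memLp k).integrable one_le_two)
  exact Lp.ext (ae_circle_iff.2
    (h.isWeakDerivOn.unique isOpen_Ioo (hint g) (hint g') h'.isWeakDerivOn))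

theorem der_succ_eq_of_der_castSucc_eq {k l : ℕ} {u : H k} {v : H l} {i : Fin k} {j : Fin l}
    (h : der u i.castSucc = der v j.castSucc) : der u i.succ = der v j.succ :=
  have hu : IsWeakDeriv (der u i.castSucc) (der u i.succ) := u.2 i
  IsWeakDeriv.unique hu (h ▸ v.2 j)

theorem toL2_injective (k : ℕ) : Function.Injective (toL2 : H k → L2) := fun u v h => by
  refine Subtype.ext (PiLp.ext fun j => ?_)
  change der u j = der v j
  induction j using Fin.induction with
  | zero => exact h
  | succ i ih => exact der_succ_eq_of_der_castSucc_eq ih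

/-- The weak derivative `∂ₓʲ` as a bounded operator from `Hᵏ` to `L²`. -/
def derL {k : ℕ} (j : Fin (k + 1)) : H k →L[ℝ] L2 :=
  (PiLp.proj 2 (fun _ : Fin (k + 1) => L2) j).comp (H k).subtypeL

theorem norm_sq_H1 (u : H 1) : ‖u‖ ^ 2 = ‖der u 0‖ ^ 2 + ‖der u 1‖ ^ 2 :=
  (PiLp.norm_sq_eq_of_L2 _ u.1).trans (Fin.sum_univ_two _)

theorem IsAbsCont.memLp_top {E : Type*} [NormedAddCommGroup E] [NormedSpace ℝ E]
    {f g : UnitAddCircle → E} (h : IsAbsCont f g) : MemLp f ∞ :=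
  memLp_top_of_bound h.integrable.aestronglyMeasurable _ h.norm_le

theorem IsAbsCont.exists_H1 {f g : UnitAddCircle → Plane} (h : IsAbsCont f g) (hg : MemLp g 2) :
    ∃ u : H 1, der u 0 =ᵐ[volume] f ∧ der u 1 =ᵐ[volume] g := by
  have hf : MemLp f 2 := h.memLp_top.mono_exponent le_top
  refine ⟨⟨WithLp.toLp 2 ![hf.toLp, hg.toLp], Fin.forall_fin_one.2 ?_⟩, hf.coeFn_toLp,
    hg.coeFn_toLp⟩
  exact (h.congr hf.coeFn_toLp.symm hg.coeFn_toLp.symm).isWeakDeriv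

theorem isAbsCont_const {E : Type*} [NormedAddCommGroup E] [NormedSpace ℝ E] (e : E) :
    IsAbsCont (fun _ => e) (fun _ => 0) where
  intervalIntegrable := intervalIntegrable_const
  integral_eq_zero := by simp
  exists_primitive := ⟨e, by simp⟩

theorem IsTest.isAbsCont {φ : UnitAddCircle → ℝ} (hφ : IsTest φ) : IsAbsCont φ (circDeriv φ) := by
  have hint : ∀ t : ℝ, ∫ s in (0 : ℝ)..t, circDeriv φ s = φ t - φ (0 : ℝ) := fun t => by
    simp only [circDeriv_coe]
    exact intervalIntegral.integral_deriv_eq_sub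
      (fun x _ => ContDiff.differentiable hφ (by simp) x)
      ((ContDiff.continuous_deriv hφ (by simp)).intervalIntegrable _ _)
  refine ⟨(hφ.continuous_circDeriv.comp (AddCircle.continuous_mk' 1)).intervalIntegrable _ _, ?_,
    φ (0 : ℝ), ae_of_all _ fun t => by rw [hint, add_sub_cancel]⟩
  rw [hint, AddCircle.coe_period, AddCircle.coe_zero, sub_self]

theorem IsTest.exists_H1 {φ : UnitAddCircle → ℝ} (hφ : IsTest φ) (e : Plane) :
    ∃ u : H 1, (∀ᵐ x, der u 0 x = φ x • e) ∧ ∀ᵐ x, der u 1 x = circDeriv φ x • e := by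
  have h := hφ.isAbsCont.bilin (ContinuousLinearMap.lsmul ℝ ℝ) (isAbsCont_const e)
  simp only [ContinuousLinearMap.lsmul_apply, smul_zero, add_zero] at h
  exact h.exists_H1 ((hφ.continuous_circDeriv.smul continuous_const).memLp_of_hasCompactSupport
    (HasCompactSupport.of_compactSpace _))

theorem IsAbsCont.exists_smul_H1 {m m' : UnitAddCircle → ℝ} (h : IsAbsCont m m')
    (hm' : MemLp m' 2) (u : H 1) : ∃ w : H 1, ∀ᵐ x, der w 0 x = m x • der u 0 x := by
  have hu : IsAbsCont (der u 0) (der u 1) := isAbsCont_der u 0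
  obtain ⟨w, hw, -⟩ := (h.bilin (ContinuousLinearMap.lsmul ℝ ℝ) hu).exists_H1
    ((hu.memLp_top.smul hm').add ((Lp.memLp (der u 1)).smul h.memLp_top))
  exact ⟨w, hw⟩

-- `H¹` functions suffice, and are all admissible, as test functions.
theorem isWeakDeriv_iff_inner {f g : L2} :
    IsWeakDeriv f g ↔ ∀ u : H 1, inner ℝ f (der u 1) = -inner ℝ g (der u 0) := by
  refine ⟨fun h u => ?_, fun h φ hφ => ext_inner_right ℝ fun e => ?_⟩
  · have hparts := (h.isAbsCont.bilin (innerSL ℝ) (isAbsCont_der u 0)).integral_circle_eq_zero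
    rw [eq_neg_iff_add_eq_zero, L2.inner_def, L2.inner_def, add_comm,
      ← integral_add (L2.integrable_inner _ _) (L2.integrable_inner _ _)]
    exact hparts
  · obtain ⟨u, hu0, hu1⟩ := hφ.exists_H1 e
    have hpair : ∀ {ψ : UnitAddCircle → ℝ} (k w : L2), Continuous ψ → (∀ᵐ x, w x = ψ x • e) →
        inner ℝ (∫ x, ψ x • k x) e = inner ℝ k w := fun {ψ} k w hψ hw => by
      have hint : Integrable fun x => ψ x • k x :=
        ((Lp.memLp k).smul (memLp_circle hψ) (r := 1)).integrable le_rfl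
      rw [real_inner_comm, ← integral_inner (𝕜 := ℝ) hint e, L2.inner_def]
      refine integral_congr_ae (hw.mono fun x hx => ?_)
      simp only [hx, real_inner_smul_right, real_inner_comm e]
    rw [inner_neg_left, hpair f _ hφ.continuous_circDeriv hu1, hpair g _ hφ.continuous hu0, h]

end Sobolev

section Elliptic

/-- Multiplication by an essentially bounded scalar function on `L²`. -/
def mulL2 (m : Lp ℝ ∞ (volume : Measure UnitAddCircle)) : L2 →L[ℝ] L2 :=
  (ContinuousLinearMap.lsmul ℝ ℝ).holderL volume ∞ 2 2 m

/-- The mass operator of the weight `m`, which represents the form `∫ m ⟪u, v⟫` on `H¹`. -/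
def massOp (m : Lp ℝ ∞ (volume : Measure UnitAddCircle)) : H 1 →L[ℝ] H 1 :=
  (derL 0).adjoint ∘L mulL2 m ∘L derL 0

/-- The stiffness operator, which represents the form `∫ ⟪∂ₓu, ∂ₓv⟫` on `H¹`. -/
def stiffnessOp : H 1 →L[ℝ] H 1 :=
  (derL 1).adjoint ∘L derL 1

theorem inner_stiffnessOp (u v : H 1) :
    inner ℝ (stiffnessOp u) v = inner ℝ (der u 1) (der v 1) :=
  (derL (k := 1) 1).adjoint_inner_left v (derL 1 u)

theorem isPositive_stiffnessOp : stiffnessOp.IsPositive :=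
  (derL 1).isPositive_adjoint_comp_self

variable {m : Lp ℝ ∞ (volume : Measure UnitAddCircle)} {c : ℝ}

theorem coeFn_mulL2 (f : L2) : ∀ᵐ x, mulL2 m f x = m x • f x :=
  (ContinuousLinearMap.lsmul ℝ ℝ).coeFn_holder m f

theorem inner_massOp (u v : H 1) :
    inner ℝ (massOp m u) v = inner ℝ (mulL2 m (der u 0)) (der v 0) :=
  (derL (k := 1) 0).adjoint_inner_left v (mulL2 m (derL 0 u))

theorem inner_mulL2 (f g : L2) : inner ℝ (mulL2 m f) g = ∫ x, m x * inner ℝ (f x) (g x) := by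
  rw [L2.inner_def]
  refine integral_congr_ae ?_
  filter_upwards [coeFn_mulL2 f] with x hx
  rw [hx, real_inner_smul_left]

theorem mul_norm_sq_le_inner_mulL2 (hm : ∀ᵐ x, c ≤ m x) (f : L2) :
    c * ‖f‖ ^ 2 ≤ inner ℝ (mulL2 m f) f := by
  rw [← real_inner_self_eq_norm_sq, L2.inner_def, L2.inner_def, ← integral_const_mul]
  refine integral_mono_ae ((L2.integrable_inner _ _).const_mul c) (L2.integrable_inner _ _) ?_
  filter_upwards [hm, coeFn_mulL2 f] with x hcx hx
  rw [hx, real_inner_smul_left]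
  exact mul_le_mul_of_nonneg_right hcx real_inner_self_nonneg

theorem isPositive_mulL2 (hm : ∀ᵐ x, 0 ≤ m x) : (mulL2 m).IsPositive := by
  refine (ContinuousLinearMap.isPositive_iff _).2 ⟨fun f g => ?_, fun f => ?_⟩
  · change inner ℝ (mulL2 m f) g = inner ℝ f (mulL2 m g)
    rw [real_inner_comm _ f, inner_mulL2, inner_mulL2]
    simp only [real_inner_comm]
  · simpa only [zero_mul] using mul_norm_sq_le_inner_mulL2 hm f

theorem isPositive_massOp (hm : ∀ᵐ x, 0 ≤ m x) : (massOp m).IsPositive :=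
  (isPositive_mulL2 hm).adjoint_conj (derL 0)

theorem massOp_injective (hc : 0 < c) (hm : ∀ᵐ x, c ≤ m x) : Function.Injective (massOp m) := by
  refine (injective_iff_map_eq_zero _).2 fun u hu => toL2_injective 1 ?_
  have hle : c * ‖der u 0‖ ^ 2 ≤ 0 := by
    simpa only [← inner_massOp, hu, inner_zero_left] using mul_norm_sq_le_inner_mulL2 hm (der u 0)
  have h0 : der u 0 = 0 :=
    norm_eq_zero.1 (pow_eq_zero_iff two_ne_zero |>.1 (by nlinarith [sq_nonneg ‖der u 0‖]))
  exact h0.trans (map_zero (derL (k := 1) 0)).symm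

theorem min_smul_one_le_massOp_add_stiffnessOp (hc : 0 ≤ c) (hm : ∀ᵐ x, c ≤ m x) :
    min c 1 • 1 ≤ massOp m + stiffnessOp := by
  have hM := isPositive_massOp (hm.mono fun x hx => hc.trans hx)
  refine smul_one_le_of_mul_norm_sq_le_inner (hM.add isPositive_stiffnessOp).isSymmetric fun u => ?_
  calc min c 1 * ‖u‖ ^ 2 = min c 1 * ‖der u 0‖ ^ 2 + min c 1 * ‖der u 1‖ ^ 2 := by
        rw [norm_sq_H1, mul_add]
    _ ≤ c * ‖der u 0‖ ^ 2 + 1 * ‖der u 1‖ ^ 2 := by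
        gcongr
        exacts [min_le_left _ _, min_le_right _ _]
    _ ≤ inner ℝ (massOp m u) u + inner ℝ (stiffnessOp u) u := by
        rw [inner_massOp, inner_stiffnessOp, one_mul, real_inner_self_eq_norm_sq]
        gcongr
        exact mul_norm_sq_le_inner_mulL2 hm _
    _ = inner ℝ ((massOp m + stiffnessOp) u) u := by rw [add_apply, inner_add_left]

theorem stiffnessOp_eq_neg_massOp_iff {u f : H 1} :
    stiffnessOp u = -massOp m f ↔ IsWeakDeriv (der u 1) (mulL2 m (der f 0)) := by
  rw [isWeakDeriv_iff_inner, ext_iff_inner_right ℝ]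
  simp only [inner_neg_left, inner_stiffnessOp, inner_massOp]

end Elliptic

section Regularity

theorem exists_clm_lift_of_injective {X Y Z : Type*} [NormedAddCommGroup X] [NormedSpace ℝ X]
    [CompleteSpace X] [NormedAddCommGroup Y] [NormedSpace ℝ Y] [CompleteSpace Y]
    [NormedAddCommGroup Z] [NormedSpace ℝ Z] {ι : Y →L[ℝ] Z} (hι : Function.Injective ι)
    {S : X →L[ℝ] Z} (h : ∀ x, ∃ y, ι y = S x) : ∃ S' : X →L[ℝ] Y, ∀ x, ι (S' x) = S x := by
  let S' : X →ₗ[ℝ] Y := (LinearEquiv.ofInjective ι.toLinearMap hι).symm.toLinearMap ∘ₗ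
    S.toLinearMap.codRestrict ι.toLinearMap.range h
  have hS' : ∀ x, ι (S' x) = S x := fun x =>
    congrArg Subtype.val ((LinearEquiv.ofInjective ι.toLinearMap hι).apply_symm_apply _)
  refine ⟨.ofSeqClosedGraph (g := S') fun u x y hu hS'u => hι ?_, hS'⟩
  refine tendsto_nhds_unique ((ι.continuous.tendsto y).comp hS'u) ?_
  simpa only [Function.comp_def, hS'] using (S.continuous.tendsto x).comp hu

variable {m : Lp ℝ ∞ (volume : Measure UnitAddCircle)} {m' : UnitAddCircle → ℝ} {c : ℝ}

theorem exists_H3_of_stiffnessOp_eq (h : IsAbsCont m m') (hm' : MemLp m' 2) {u f : H 1}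
    (hu : stiffnessOp u = -massOp m f) : ∃ v : H 3, toL2 v = toL2 u := by
  obtain ⟨w, hw⟩ := h.exists_smul_H1 hm' f
  have hw0 : der w 0 = mulL2 m (der f 0) := Lp.ext <| by
    filter_upwards [hw, coeFn_mulL2 (m := m) (der f 0)] with x hwx hmx
    rw [hwx, hmx]
  have hu2 : IsWeakDeriv (der u 1) (der w 0) := hw0 ▸ stiffnessOp_eq_neg_massOp_iff.1 hu
  refine ⟨⟨WithLp.toLp 2 ![der u 0, der u 1, der w 0, der w 1], fun j => ?_⟩, rfl⟩
  fin_cases j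
  exacts [u.2 0, hu2, w.2 0]

theorem exists_resolvent_H3 (hc : 0 < c) (hm : ∀ᵐ x, c ≤ m x) (h : IsAbsCont m m')
    (hm' : MemLp m' 2) : ∃ S : H 1 →L[ℝ] H 3, ∀ u f,
      massOp m u + stiffnessOp u = massOp m f → toL2 u = toL2 (S f) := by
  have hκ : 0 < min c 1 := lt_min hc one_pos
  have hcoer := min_smul_one_le_massOp_add_stiffnessOp hc.le hm
  obtain ⟨R, hR, -⟩ := exists_resolvent
    (isPositive_massOp (hm.mono fun x hx => hc.le.trans hx)) isPositive_stiffnessOp hκ hcoer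
  have hRf : ∀ f, massOp m (R f) + stiffnessOp (R f) = massOp m f := fun f => congr($hR f)
  obtain ⟨S, hS⟩ := exists_clm_lift_of_injective (ι := derL (k := 3) 0) (S := derL 0 ∘L R)
    (toL2_injective 3) fun f => exists_H3_of_stiffnessOp_eq h hm' (u := R f) (f := R f - f) (by
      rw [map_sub, neg_sub, ← hRf f, add_sub_cancel_left])
  refine ⟨S, fun u f hu => (congrArg toL2 ?_).trans (hS f).symm⟩
  refine (ContinuousLinearMap.isUnit_iff_bijective.1 (isUnit_of_smul_one_le hκ hcoer)).1 ?_
  exact hu.trans (hRf f).symm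

end Regularity

section Speed

theorem isAbsCont_pi_mul_norm_sq_der (η : H 2) : IsAbsCont (fun x => Real.pi * ‖der η 1 x‖ ^ 2)
    (fun x => Real.pi * (2 * inner ℝ (der η 1 x) (der η 2 x))) := by
  have hη : IsAbsCont (der η 1) (der η 2) := isAbsCont_der η 1
  refine (hη.bilin (Real.pi • (innerSL ℝ : Plane →L[ℝ] Plane →L[ℝ] ℝ)) hη).congr
    (ae_of_all _ fun x => ?_) (ae_of_all _ fun x => ?_)
  · change Real.pi * inner ℝ (der η 1 x) (der η 1 x) = _
    rw [real_inner_self_eq_norm_sq]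
  · change Real.pi * inner ℝ (der η 2 x) (der η 1 x) + Real.pi * inner ℝ (der η 1 x) (der η 2 x) = _
    rw [real_inner_comm, ← mul_add, ← two_mul]

/-- The weight `π |∂ₓη|²`, the reciprocal of the coefficient of `A η`. -/
def speedWeight (η : H 2) : Lp ℝ ∞ (volume : Measure UnitAddCircle) :=
  (isAbsCont_pi_mul_norm_sq_der η).memLp_top.toLp _

variable {η : H 2} {κ : ℝ}

theorem coeFn_speedWeight (η : H 2) :
    speedWeight η =ᵐ[volume] fun x => Real.pi * ‖der η 1 x‖ ^ 2 :=
  (isAbsCont_pi_mul_norm_sq_der η).memLp_top.coeFn_toLp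

theorem exists_isAbsCont_speedWeight (η : H 2) :
    ∃ m' : UnitAddCircle → ℝ, MemLp m' 2 ∧ IsAbsCont (speedWeight η) m' := by
  have hη : IsAbsCont (der η 1) (der η 2) := isAbsCont_der η 1
  have hinner : MemLp (fun x => inner ℝ (der η 1 x) (der η 2 x)) 2 :=
    (innerSL ℝ : Plane →L[ℝ] Plane →L[ℝ] ℝ).memLp_of_bilin 2 hη.memLp_top (Lp.memLp (der η 2))
  exact ⟨_, (hinner.const_mul 2).const_mul Real.pi,
    (isAbsCont_pi_mul_norm_sq_der η).congr (coeFn_speedWeight η).symm (ae_eq_refl _)⟩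

theorem le_speedWeight (hκ : 0 ≤ κ) (hη : ∀ᵐ x, κ ≤ ‖der η 1 x‖) :
    ∀ᵐ x, Real.pi * κ ^ 2 ≤ speedWeight η x := by
  filter_upwards [hη, coeFn_speedWeight η] with x hx hw
  rw [hw]
  gcongr

theorem ae_eq_A_add_iff (hκ : 0 < κ) (hη : ∀ᵐ x, κ ≤ ‖der η 1 x‖) {u p g : H 1} {v : H 3}
    (huv : toL2 u = toL2 v) : (∀ᵐ x, toL2 p x = A η v x + toL2 g x) ↔
      massOp (speedWeight η) p + stiffnessOp u = massOp (speedWeight η) g := by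
  have hder : der u 1 = der v 1 := der_succ_eq_of_der_castSucc_eq (i := 0) (j := 0) huv
  have hv : IsWeakDeriv (der v 1) (der v 2) := v.2 1
  have hweak : IsWeakDeriv (der u 1) (mulL2 (speedWeight η) (der (p - g) 0)) ↔
      der v 2 = mulL2 (speedWeight η) (der (p - g) 0) :=
    ⟨fun h => hv.unique (hder ▸ h), fun h => h ▸ hder ▸ hv⟩
  rw [← eq_sub_iff_add_eq', ← neg_sub, ← map_sub, stiffnessOp_eq_neg_massOp_iff, hweak, Lp.ext_iff]
  refine eventually_congr ?_
  filter_upwards [hη, coeFn_speedWeight η, coeFn_mulL2 (m := speedWeight η) (der (p - g) 0),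
    Lp.coeFn_sub (der p 0) (der g 0)] with x hx hw hm hsub
  have hpos : Real.pi * ‖der η 1 x‖ ^ 2 ≠ 0 := by
    have := hκ.trans_le hx
    positivity
  have hsub' : der (p - g) 0 x = toL2 p x - toL2 g x := hsub
  rw [hm, hw, hsub', A, ← sub_eq_iff_eq_add, eq_comm, inv_smul_eq_iff₀ hpos]

end Speed

section MaximalRegularity

variable {T : ℝ}

theorem E_ext_iff {γ γ' : E T} :
    γ = γ' ↔ inH1 γ = inH1 γ' ∧ dt γ = dt γ' ∧ inH3 γ = inH3 γ' := by
  refine ⟨fun h => h ▸ ⟨rfl, rfl, rfl⟩, fun ⟨h1, hdt, h3⟩ => ?_⟩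
  exact Subtype.ext (WithLp.ofLp_injective 2 (Prod.ext
    (Subtype.ext (WithLp.ofLp_injective 2 (Prod.ext h1 hdt))) h3))

theorem norm_E_le (γ : E T) : ‖γ‖ ≤ ‖inH1 γ‖ + ‖dt γ‖ + ‖inH3 γ‖ := by
  have hE : ‖γ‖ ^ 2 = ‖γ.1.fst.1‖ ^ 2 + ‖inH3 γ‖ ^ 2 := WithLp.prod_norm_sq_eq_of_L2 γ.1
  have hH1 : ‖γ.1.fst.1‖ ^ 2 = ‖inH1 γ‖ ^ 2 + ‖dt γ‖ ^ 2 := WithLp.prod_norm_sq_eq_of_L2 γ.1.fst.1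
  refine le_of_sq_le_sq ?_ (by positivity)
  rw [hE, hH1]
  nlinarith [norm_nonneg (inH1 γ), norm_nonneg (dt γ), norm_nonneg (inH3 γ)]

theorem exists_E_norm_le_and_iff {u p : TimeL2 T (H 1)} {v : TimeL2 T (H 3)}
    (hu : u =ᵐ[timeMeasure T] fun t => ∫ r in (0 : ℝ)..t, p r)
    (huv : ∀ᵐ t ∂timeMeasure T, toL2 (u t) = toL2 (v t)) :
    ∃ γ : E T, ‖γ‖ ≤ ‖u‖ + ‖p‖ + ‖v‖ ∧
      ∀ γ', γ' = γ ↔ inH1 γ' = u ∧ dt γ' = p ∧ inH3 γ' = v :=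
  ⟨⟨WithLp.toLp 2 (⟨_, mem_timeH1_of_ae_eq_primitive hu⟩, v), huv⟩, norm_E_le _, fun _ => E_ext_iff⟩

variable {η : H 2} {κ : ℝ}

theorem ae_eq_A_inH3_add_iff (hκ : 0 < κ) (hη : ∀ᵐ x, κ ≤ ‖der η 1 x‖) (g : TimeL2 T (H 1))
    (γ : E T) : (∀ᵐ t ∂timeMeasure T, ∀ᵐ x : UnitAddCircle,
      toL2 (dt γ t) x = A η (inH3 γ t) x + toL2 (g t) x) ↔
      ∀ᵐ t ∂timeMeasure T, massOp (speedWeight η) (dt γ t) + stiffnessOp (inH1 γ t) =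
        massOp (speedWeight η) (g t) := by
  refine eventually_congr ?_
  filter_upwards [γ.2] with t hγ
  exact ae_eq_A_add_iff hκ hη hγ

theorem isSolution_iff (hκ : 0 < κ) (hη : ∀ᵐ x, κ ≤ ‖der η 1 x‖) (hT : 0 < T)
    (g : TimeL2 T (H 1)) (γ : E T) : IsSolution η g γ ↔
      (inH1 γ =ᵐ[timeMeasure T] fun t => ∫ r in (0 : ℝ)..t, dt γ r) ∧
      (∀ᵐ t ∂timeMeasure T, massOp (speedWeight η) (dt γ t) + stiffnessOp (inH1 γ t) =
        massOp (speedWeight η) (g t)) ∧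
      ∀ᵐ t ∂timeMeasure T, toL2 (inH1 γ t) = toL2 (inH3 γ t) :=
  and_comm.trans (and_congr (exists_continuousOn_zero_iff_ae_eq_primitive hT γ.1.fst.2)
    ((ae_eq_A_inH3_add_iff hκ hη g γ).trans (and_iff_left γ.2).symm))

theorem exists_solution_components (hκ : 0 < κ) (hη : ∀ᵐ x, κ ≤ ‖der η 1 x‖) (T : ℝ) :
    ∃ C, 0 < C ∧ ∀ g : TimeL2 T (H 1), ∃ (u p : TimeL2 T (H 1)) (v : TimeL2 T (H 3)),
      ‖u‖ + ‖p‖ + ‖v‖ ≤ C * ‖g‖ ∧ ∀ (u' p' : TimeL2 T (H 1)) (v' : TimeL2 T (H 3)),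
        ((u' =ᵐ[timeMeasure T] fun t => ∫ r in (0 : ℝ)..t, p' r) ∧
          (∀ᵐ t ∂timeMeasure T, massOp (speedWeight η) (p' t) + stiffnessOp (u' t) =
            massOp (speedWeight η) (g t)) ∧
          ∀ᵐ t ∂timeMeasure T, toL2 (u' t) = toL2 (v' t)) ↔ u' = u ∧ p' = p ∧ v' = v := by
  have hc : 0 < Real.pi * κ ^ 2 := by positivity
  have hm := le_speedWeight hκ.le hη
  obtain ⟨m', hm', hac⟩ := exists_isAbsCont_speedWeight η
  obtain ⟨S, hS⟩ := exists_resolvent_H3 hc hm hac hm'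
  exact exists_regular_evolution_solution
    (isPositive_massOp (hm.mono fun x hx => hc.le.trans hx)) isPositive_stiffnessOp
    (massOp_injective hc hm) (lt_min hc one_pos) (min_smul_one_le_massOp_add_stiffnessOp hc.le hm)
    (toL2_injective 3) hS

theorem exists_isSolution_iff (hκ : 0 < κ) (hη : ∀ᵐ x, κ ≤ ‖der η 1 x‖) (hT : 0 < T) :
    ∃ C, 0 < C ∧ ∀ g : TimeL2 T (H 1), ∃ γ : E T, ‖γ‖ ≤ C * ‖g‖ ∧
      ∀ γ' : E T, IsSolution η g γ' ↔ γ' = γ := by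
  choose C hC u p v hbound huniq using exists_solution_components hκ hη T
  have hsol := fun g => (huniq g _ _ _).2 ⟨rfl, rfl, rfl⟩
  exact ⟨C, hC, fun g => (exists_E_norm_le_and_iff (hsol g).1 (hsol g).2.2).imp fun γ hγ =>
    ⟨hγ.1.trans (hbound g), fun γ' =>
      (isSolution_iff hκ hη hT g γ').trans ((huniq g _ _ _).trans (hγ.2 γ').symm)⟩⟩

end MaximalRegularity

end

end ILLSS

theorem proposition4p13_general (η : ILLSS.H 2) {κ : ℝ} (hκ : 0 < κ)
    (hη : ∀ᵐ x, κ ≤ ‖ILLSS.der η 1 x‖) (T : ℝ) (hT : 0 < T) :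
    (∀ g : ILLSS.TimeL2 T (ILLSS.H 1), ∃! γ : ILLSS.E T, ILLSS.IsSolution η g γ) ∧
    ∃ C : ℝ, 0 < C ∧ ∀ (g : ILLSS.TimeL2 T (ILLSS.H 1)) (γ : ILLSS.E T),
      ILLSS.IsSolution η g γ → ‖γ‖ ≤ C * ‖g‖ := by
  choose C hC Γ hbound hΓ using ILLSS.exists_isSolution_iff hκ hη hT
  exact ⟨fun g => ⟨Γ g, (hΓ g _).2 rfl, fun γ => (hΓ g γ).1⟩, C, hC,
    fun g γ hγ => (congrArg norm ((hΓ g γ).1 hγ)).trans_le (hbound g)⟩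

theorem proposition4p13 (η : ILLSS.H 2) (hη : η ∈ ILLSS.V) (T : ℝ) (hT : 0 < T) :
    (∀ g : ILLSS.TimeL2 T (ILLSS.H 1), ∃! γ : ILLSS.E T, ILLSS.IsSolution η g γ) ∧
    ∃ C : ℝ, 0 < C ∧ ∀ (g : ILLSS.TimeL2 T (ILLSS.H 1)) (γ : ILLSS.E T),
      ILLSS.IsSolution η g γ → ‖γ‖ ≤ C * ‖g‖ :=
  (ILLSS.exists_speed_lower_bound_of_mem_V hη).elim fun _ hκ =>
    proposition4p13_general η hκ.1 hκ.2 T hT
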